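/- Let $(M,\rho)$ be an infinite compact metric space and $\mu$ a finite Borel measure on $M$ that is doubling: for some $D>0$, $0<|B(x,2r)|\le 2^D|B(x,r)|$ for all $x\in M$, $r>0$, where $B(x,r)$ is the open ball and $|B(x,r)|=\mu(B(x,r))$. Let $L$ be a nonnegative self-adjoint operator on the real space $L^2(M,\mu)$ such that, for every $t>0$, $e^{-tL}f(x)=\int_M P_t(x,y)f(y)\,d\mu(y)$ with a kernel $P_t\ge 0$ satisfying $P_t(x,y)=P_t(y,x)$, $\int_M P_t(x,y)\,d\mu(y)=1$ and $P_{t+u}(x,y)=\int_M P_t(x,z)P_u(z,y)\,d\mu(z)$. Suppose that there are $C_1,c_1,\alpha>0$ such that, for all $t\in(0,1)$ and $x,y,y'\in M$, $$P_t(x,y)\le \frac{C_1e^{-c_1\rho(x,y)^2/t}}{\sqrt{|B(x,\sqrt t)||B(y,\sqrt t)|}},\qquad |P_t(x,y)-P_t(x,y')|\le\Big(\frac{\rho(y,y')}{\sqrt t}\Big)^{\alpha}\frac{C_1e^{-c_1\rho(x,y)^2/t}}{\sqrt{|B(x,\sqrt t)||B(y,\sqrt t)|}}\ \text{ if }\rho(y,y')\le\sqrt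 t .$$ Let $\mathbb H_t$ be the reproducing kernel Hilbert space of functions on $M$ with kernel $P_t$. Let $\Phi:[0,\infty)\to\mathbb R$ be a smooth function, supported in $[0,2]$, with $|\Phi|=1$ on $[0,1]$ and $\Phi\ge 0$ on $[1,\infty)$, and for $s>0$ put $$\|f\|_{B^s_{2,\infty}}=\sup_{j\ge 0}2^{sj}\|\Phi(2^{-j}\sqrt L)f-f\|_2,$$ where $F(\sqrt L)f=\sum_{\lambda}F(\sqrt\lambda)P_{\lambda}f$ is the sum over the eigenvalues $\lambda$ of $L$, with $P_\lambda$ the orthogonal projection onto the eigenspace. Then for each $s>0$ there are $f\in L^2(M,\mu)$ with $\|f\|_{B^s_{2,\infty}}\le 1$ and $\|f\|_2=1$, and a constant $c>0$, such that for every $\varepsilon_0\in(0,1)$ there is a constant $C>0$ such that, for all $t\in(0,1]$ and $\varepsilon\in(0,\varepsilon_0]$, $$\inf\{\|h\|_{\mathbb H_t}^2 : h\in\mathbb H_t,\ \|f-h\|_2\le\varepsilon\}\ \ge\ C\,\varepsilon^2\exp\!\big(c\,t\,\varepsilon^{-2/s}\big).$$ -/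

import Mathlib

open MeasureTheory Filter Topology Set
open scoped ENNReal InnerProductSpace ContDiff

noncomputable section

namespace HeatRKHS

/-- The doubling property: for some `D > 0`, `0 < |B(x, 2r)| ≤ 2 ^ D |B(x, r)|` for every point `x`
and every radius `r > 0`. -/
def Doubling {M : Type*} [MetricSpace M] [MeasurableSpace M] (μ : Measure M) : Prop :=
  ∃ D : ℝ, 0 < D ∧ ∀ (x : M) (r : ℝ), 0 < r →
    0 < μ (Metric.ball x (2 * r)) ∧
      μ (Metric.ball x (2 * r)) ≤ ENNReal.ofReal (2 ^ D) * μ (Metric.ball x r)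

/-- `S t = e^{-tL}`: the operators `S t`, `t ≥ 0`, form a strongly continuous semigroup of bounded
operators whose infinitesimal generator is `-L` (same domain, same values). -/
structure IsSemigroupOf {E : Type*} [NormedAddCommGroup E] [NormedSpace ℝ E]
    (L : E →ₗ.[ℝ] E) (S : ℝ → E →L[ℝ] E) : Prop where
  zero : S 0 = 1
  add : ∀ s t : ℝ, 0 ≤ s → 0 ≤ t → S (s + t) = S s * S t
  continuous : ∀ f : E, Tendsto (fun t => S t f) (𝓝[>] 0) (𝓝 f)
  generator : ∀ f g : E, (f, g) ∈ L.graph ↔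
    Tendsto (fun t : ℝ => t⁻¹ • (f - S t f)) (𝓝[>] 0) (𝓝 g)

/-- The operators `S t` on `L²(μ)`, `t > 0`, are Markov kernel operators with the (heat) kernel
`P t x y`: nonnegative, symmetric, of total mass one, with the Chapman–Kolmogorov property. -/
structure IsHeatKernel {M : Type*} [MeasurableSpace M] (μ : Measure M)
    (S : ℝ → Lp ℝ 2 μ →L[ℝ] Lp ℝ 2 μ) (P : ℝ → M → M → ℝ) : Prop where
  measurable : ∀ t, 0 < t → Measurable (Function.uncurry (P t))
  nonneg : ∀ t, 0 < t → ∀ x y, 0 ≤ P t x y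
  apply_eq : ∀ t, 0 < t → ∀ f : Lp ℝ 2 μ, ∀ᵐ x ∂μ, S t f x = ∫ y, P t x y * f y ∂μ
  symm : ∀ t, 0 < t → ∀ x y, P t x y = P t y x
  mass : ∀ t, 0 < t → ∀ x, ∫ y, P t x y ∂μ = 1
  chapman : ∀ t s, 0 < t → 0 < s → ∀ x y,
    Integrable (fun u => P t x u * P s u y) μ ∧ P (t + s) x y = ∫ u, P t x u * P s u y ∂μ

/-- The factor `C / √(|B(x, √t)| |B(y, √t)|) * exp (-c ρ(x, y)² / t)`. -/
def gaussianFactor {M : Type*} [MetricSpace M] [MeasurableSpace M] (μ : Measure M)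
    (C c t : ℝ) (x y : M) : ℝ :=
  C / √(μ.real (Metric.ball x √t) * μ.real (Metric.ball y √t)) * Real.exp (-c * dist x y ^ 2 / t)

/-- Small time Gaussian upper bound and Hölder continuity of the heat kernel. -/
def GaussianBounds {M : Type*} [MetricSpace M] [MeasurableSpace M] (μ : Measure M)
    (P : ℝ → M → M → ℝ) : Prop :=
  ∃ C c α : ℝ, 0 < C ∧ 0 < c ∧ 0 < α ∧ ∀ t, 0 < t → t < 1 →
    (∀ x y, P t x y ≤ gaussianFactor μ C c t x y) ∧
    ∀ x y y', dist y y' ≤ √t →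
      |P t x y - P t x y'| ≤ (dist y y' / √t) ^ α * gaussianFactor μ C c t x y

/-- The eigenspace `{f ∈ dom L : L f = l f}`. -/
def eigenspace {E : Type*} [NormedAddCommGroup E] [NormedSpace ℝ E]
    (L : E →ₗ.[ℝ] E) (l : ℝ) : Submodule ℝ E :=
  L.graph.comap (LinearMap.prod LinearMap.id (l • LinearMap.id))

/-- The function `F(√L)` of a nonnegative self-adjoint operator `L` with pure point spectrum:
`F(√L) f = ∑ₗ F(√l) Pₗ f`, the sum of the orthogonal projections of `f` onto the eigenspaces of `L`.
Eigenspaces of a self-adjoint operator are closed, so the closure changes nothing; the real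
numbers `l` that are not eigenvalues contribute zero. -/
def sqrtCalculus {E : Type*} [NormedAddCommGroup E] [InnerProductSpace ℝ E] [CompleteSpace E]
    (L : E →ₗ.[ℝ] E) (F : ℝ → ℝ) (f : E) : E :=
  ∑' l : ℝ, F √l • (eigenspace L l).topologicalClosure.starProjection f

/-- A Littlewood–Paley function on `[0, ∞)`: smooth, supported in `[0, 2]`, of modulus one
on `[0, 1]` and nonnegative on `[1, ∞)`. -/
structure IsLittlewoodPaley (Φ : ℝ → ℝ) : Prop where
  smooth : ContDiffOn ℝ ∞ Φ (Ici 0)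
  support : ∀ x, 2 < x → Φ x = 0
  nonneg : ∀ x, 1 ≤ x → 0 ≤ Φ x
  abs_eq_one : ∀ x, 0 ≤ x → x ≤ 1 → |Φ x| = 1

/-- The Besov functional `‖f‖_{B^s_{2,∞}} = sup_{j ≥ 0} 2^{sj} ‖Φ(2^{-j}√L) f - f‖₂`. -/
def besovNorm {E : Type*} [NormedAddCommGroup E] [InnerProductSpace ℝ E] [CompleteSpace E]
    (L : E →ₗ.[ℝ] E) (Φ : ℝ → ℝ) (s : ℝ) (f : E) : ℝ≥0∞ :=
  ⨆ j : ℕ, ENNReal.ofReal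
    ((2 : ℝ) ^ (s * j) * ‖sqrtCalculus L (fun x => Φ (2 ^ (-(j : ℝ)) * x)) f - f‖)

/-- A real kernel `K(x, y)` as a matrix of operators on `ℝ`. -/
def kernelMatrix {M : Type*} (K : M → M → ℝ) : Matrix M M (ℝ →L[ℝ] ℝ) :=
  Matrix.of fun x y => K x y • (1 : ℝ →L[ℝ] ℝ)

/-- The heat kernel at a positive time is a positive semidefinite kernel. -/
theorem IsHeatKernel.posSemidef {M : Type*} [MeasurableSpace M] {μ : Measure M}
    {S : ℝ → Lp ℝ 2 μ →L[ℝ] Lp ℝ 2 μ} {P : ℝ → M → M → ℝ} (hP : IsHeatKernel μ S P)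
    {t : ℝ} (ht : 0 < t) : (kernelMatrix (P t)).PosSemidef := by
  refine ((RKHS.posSemidef_tfae (K := kernelMatrix (P t))).out 0 1 :
    _ ↔ (kernelMatrix (P t)).IsHermitian ∧ _).mpr ⟨?_, fun f => ?_⟩
  · ext x y
    simp [kernelMatrix, Matrix.conjTranspose_apply, hP.symm t ht x y, star_smul]
  · have ht2 : 0 < t / 2 := by linarith
    have key : ∀ x y, Integrable (fun u => P (t / 2) x u * P (t / 2) y u) μ ∧
        P t x y = ∫ u, P (t / 2) x u * P (t / 2) y u ∂μ := by
      intro x y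
      have h := hP.chapman (t / 2) (t / 2) ht2 ht2 x y
      rw [add_halves] at h
      simpa only [hP.symm (t / 2) ht2 _ y] using h
    have hsum : (f.sum fun xv z => f.sum fun xv' w =>
        (starRingEnd ℝ) z * w * ⟪kernelMatrix (P t) xv'.1 xv.1 xv.2, xv'.2⟫_ℝ) =
        ∫ u, (∑ a ∈ f.support, f a * a.2 * P (t / 2) a.1 u) ^ 2 ∂μ := by
      have : ∀ u, (∑ a ∈ f.support, f a * a.2 * P (t / 2) a.1 u) ^ 2 =
          ∑ a ∈ f.support, ∑ b ∈ f.support,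
            (f a * f b * a.2 * b.2) * (P (t / 2) b.1 u * P (t / 2) a.1 u) := by
        intro u
        rw [sq, Finset.sum_mul_sum]
        refine Finset.sum_congr rfl fun a _ => Finset.sum_congr rfl fun b _ => by ring
      simp_rw [this]
      rw [integral_finsetSum _ fun a _ => integrable_finsetSum _ fun b _ =>
        ((key b.1 a.1).1.const_mul _)]
      refine Finset.sum_congr rfl fun a _ => ?_
      rw [integral_finsetSum _ fun b _ => ((key b.1 a.1).1.const_mul _)]
      refine Finset.sum_congr rfl fun b _ => ?_
      rw [integral_const_mul, ← (key b.1 a.1).2]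
      simp [kernelMatrix]
      ring
    rw [hsum]
    simpa using integral_nonneg fun u => sq_nonneg _

/-- `inf {‖h‖²_H : h ∈ H, ‖f - h‖₂ ≤ ε}`, where `H` is the reproducing kernel Hilbert space (of
functions on `M`) of the positive semidefinite kernel `K`. -/
def rkhsApprox {M : Type*} [MeasurableSpace M] (μ : Measure M) (K : M → M → ℝ)
    (hK : (kernelMatrix K).PosSemidef) (f : M → ℝ) (ε : ℝ) : ℝ≥0∞ :=
  haveI : Fact (kernelMatrix K).PosSemidef := ⟨hK⟩
  ⨅ h : RKHS.OfKernel (kernelMatrix K),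
    ⨅ _ : eLpNorm (fun x => f x - h x) 2 μ ≤ ENNReal.ofReal ε, ENNReal.ofReal (‖h‖ ^ 2)

end HeatRKHS

end

set_option linter.unusedSectionVars false

/-! An element of the RKHS of `P t` is `S (t / 2) g` with `‖g‖₂` equal to its RKHS norm, whence
`|⟪v, h⟫| ≤ ‖S (t / 2) v‖ ‖h‖` (`rkhs_pairing_le`). If `v` is a unit eigenvector with eigenvalue
`l`, `⟪v, f⟫ ≥ 2ε` and `‖f - h‖₂ ≤ ε`, this gives `‖h‖ ≥ ε exp (l t / 2)`. It therefore suffices to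
find one `f` in the Besov ball that, for each small `ε`, has a coefficient at least `2ε` at an
eigenvalue of order at least `ε ^ (-2 / s)`. A lacunary series does this: one eigenvector `v n` for
each window `(Λ β ^ n, Λ β ^ (n + 1))`, with coefficient `δ (Λ β ^ n) ^ (-s / 2)`, plus a multiple
of the constant function that makes the norm one (`exists_besov_function`).

The analytic core is that the spectrum has no large multiplicative gaps (`exists_window`). The
diagonal `P t x x` is comparable to `1 / |B(x, √t)|`. Across a gap from `Λ` to `β Λ`, the low modes
keep the diagonal almost constant between the time scales `1 / (β Λ)` and `1 / Λ`, while the high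
modes are negligible. This contradicts reverse doubling of the volume at `x`.

Reverse doubling needs nonempty annuli around `x`, and connectedness is not assumed. Instead `x` is
an accumulation point, which carries no mass. If an annulus around a ball is empty, the Gaussian
decay makes the indicator of the ball invariant under the semigroup, and boundedness of `P 1` then
bounds the measure of the ball from below (`exists_isolated_ball_lower`). Hence small balls at `x`
always have nonempty annuli. -/

namespace HeatRKHS

universe u

/-! ### Spectral resolution of symmetric semigroups containing a compact operator -/

section Semigroup

variable {E : Type*} [NormedAddCommGroup E] [InnerProductSpace ℝ E]

/-- A compact symmetric operator has a Hilbert basis of eigenvectors. -/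
theorem exists_hilbertBasis_eigenvectors {E : Type u} [NormedAddCommGroup E]
    [InnerProductSpace ℝ E] [CompleteSpace E] (T : E →L[ℝ] E) (hT : IsCompactOperator T)
    (hT' : (T : E →ₗ[ℝ] E).IsSymmetric) :
    ∃ (ι : Type u) (b : HilbertBasis ι ℝ E) (m : ι → ℝ), ∀ i, T (b i) = m i • b i := by
  let V : ℝ → Submodule ℝ E := fun l => Module.End.eigenspace (T : Module.End ℝ E) l
  have hclosed : ∀ l, IsClosed (V l : Set E) := by
    intro l
    have : (V l : Set E) = {x | T x = l • x} := by
      ext x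
      simp [V]
    rw [this]
    exact isClosed_eq T.continuous (continuous_const_smul l)
  have : ∀ l, CompleteSpace (V l) := fun l => (hclosed l).completeSpace_coe
  choose w b hb using fun l => exists_hilbertBasis ℝ (V l)
  have hfam : OrthogonalFamily ℝ (fun l => V l) fun l => (V l).subtypeₗᵢ :=
    hT'.orthogonalFamily_eigenspaces
  have hon : Orthonormal ℝ fun a : Σ l, w l => ((b a.1 a.2 : V a.1) : E) :=
    hfam.orthonormal_sigma_orthonormal (v_family := fun l => ⇑(b l)) fun l => (b l).orthonormal
  have hbot : (Submodule.span ℝ (Set.range fun a : Σ l, w l => ((b a.1 a.2 : V a.1) : E)))ᗮ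
      = ⊥ := by
    rw [eq_bot_iff, ← ContinuousLinearMap.orthogonalComplement_iSup_eigenspaces_eq_bot hT hT']
    intro x hx
    rw [Submodule.mem_orthogonal] at hx ⊢
    have hmem : ∀ l, V l ≤ (Submodule.span ℝ {x})ᗮ := by
      intro l y hy
      have hd := (b l).dense_span
      have hcl : IsClosed {z : V l | ⟪x, (z : E)⟫_ℝ = 0} :=
        isClosed_eq (by fun_prop) continuous_const
      have hsub : (Submodule.span ℝ (Set.range (b l)) : Set (V l)) ⊆
          {z : V l | ⟪x, (z : E)⟫_ℝ = 0} := by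
        intro z hz
        induction hz using Submodule.span_induction with
        | mem z hz =>
          obtain ⟨i, rfl⟩ := hz
          show ⟪x, _⟫_ℝ = 0
          rw [real_inner_comm]
          exact hx _ (Submodule.subset_span ⟨⟨l, i⟩, rfl⟩)
        | zero => simp
        | add u v _ _ hu hv =>
          simp only [Set.mem_ofPred_eq, Submodule.coe_add, inner_add_right] at hu hv ⊢
          rw [hu, hv, add_zero]
        | smul c u _ hu =>
          simp only [Set.mem_ofPred_eq, Submodule.coe_smul, inner_smul_right] at hu ⊢
          rw [hu, mul_zero]
      have : (⟨y, hy⟩ : V l) ∈ closure (Submodule.span ℝ (Set.range (b l)) : Set (V l)) := by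
        rw [← Submodule.topologicalClosure_coe, hd]
        trivial
      rw [Submodule.mem_orthogonal_singleton_iff_inner_right]
      exact closure_minimal hsub hcl this
    intro u hu
    have := (iSup_le hmem) hu
    rwa [Submodule.mem_orthogonal_singleton_iff_inner_left] at this
  refine ⟨Σ l, w l, HilbertBasis.mkOfOrthogonalEqBot hon hbot, fun a => a.1, fun a => ?_⟩
  rw [HilbertBasis.coe_mkOfOrthogonalEqBot]
  exact Module.End.mem_eigenspace_iff.1 (b a.1 a.2).2

variable {L : E →ₗ.[ℝ] E} {S : ℝ → E →L[ℝ] E}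

/-- In a semigroup of symmetric operators, `⟪S t v, v⟫ = ‖S (t / 2) v‖ ^ 2`. -/
theorem IsSemigroupOf.inner_self_eq (hS : IsSemigroupOf L S)
    (hsym : ∀ t, 0 < t → ∀ u v, ⟪S t u, v⟫_ℝ = ⟪u, S t v⟫_ℝ) {t : ℝ} (ht : 0 < t) (v : E) :
    ⟪S t v, v⟫_ℝ = ‖S (t / 2) v‖ ^ 2 := by
  have h2 : 0 < t / 2 := by linarith
  have h := hS.add (t / 2) (t / 2) h2.le h2.le
  rw [add_halves] at h
  rw [h, mul_apply_eq_comp, hsym _ h2, real_inner_self_eq_norm_sq]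

/-- With `r` the positive square root of the eigenvalue, `S (t / 2)` acts as `-r` on the defect `w =
S (t / 2) v - r • v`. As `S (t / 2)` is a positive operator, `w = 0`. -/
theorem IsSemigroupOf.eigenvector_half (hS : IsSemigroupOf L S)
    (hsym : ∀ t, 0 < t → ∀ u v, ⟪S t u, v⟫_ℝ = ⟪u, S t v⟫_ℝ) {t l : ℝ} (ht : 0 < t) {v : E}
    (hv : S t v = Real.exp (-l * t) • v) : S (t / 2) v = Real.exp (-l * (t / 2)) • v := by
  have h2 : 0 < t / 2 := by linarith
  have h := hS.add (t / 2) (t / 2) h2.le h2.le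
  rw [add_halves] at h
  rw [h, mul_apply_eq_comp] at hv
  set r := Real.exp (-l * (t / 2)) with hr
  have hrpos : 0 < r := Real.exp_pos _
  have hrr : Real.exp (-l * t) = r * r := by rw [hr, ← Real.exp_add]; ring_nf
  set w := S (t / 2) v - r • v with hw
  have hAw : S (t / 2) w = -r • w := by
    rw [hw, map_sub, hv, map_smul, hrr]
    module
  have hpos : 0 ≤ ⟪S (t / 2) w, w⟫_ℝ := by
    rw [hS.inner_self_eq hsym h2]
    positivity
  rw [hAw, inner_smul_left, real_inner_self_eq_norm_sq] at hpos
  have hz : ‖w‖ ^ 2 = 0 := by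
    simp only [map_neg, conj_trivial] at hpos
    nlinarith [sq_nonneg ‖w‖]
  have : w = 0 := by simpa using hz
  exact sub_eq_zero.1 this

theorem IsSemigroupOf.eigenvector_nat_mul (hS : IsSemigroupOf L S) {t l : ℝ} (ht : 0 < t)
    {v : E} (hv : S t v = Real.exp (-l * t) • v) (k : ℕ) :
    S (k * t) v = Real.exp (-l * (k * t)) • v := by
  induction k with
  | zero => simp [hS.zero]
  | succ k ih =>
    have : ((k + 1 : ℕ) : ℝ) * t = t + k * t := by push_cast; ring
    rw [this, hS.add _ _ ht.le (by positivity), mul_apply_eq_comp, ih, map_smul, hv,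
      smul_smul, ← Real.exp_add]
    ring_nf

/-- An eigenvector of one operator of a symmetric semigroup is an eigenvector of all of them. -/
theorem IsSemigroupOf.eigenvector_all (hS : IsSemigroupOf L S)
    (hsym : ∀ t, 0 < t → ∀ u v, ⟪S t u, v⟫_ℝ = ⟪u, S t v⟫_ℝ) {t₀ l : ℝ} (ht₀ : 0 < t₀) {v : E}
    (hv : S t₀ v = Real.exp (-l * t₀) • v) {t : ℝ} (ht : 0 ≤ t) :
    S t v = Real.exp (-l * t) • v := by
  have hdy : ∀ n : ℕ, S (t₀ / 2 ^ n) v = Real.exp (-l * (t₀ / 2 ^ n)) • v := by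
    intro n
    induction n with
    | zero => simpa using hv
    | succ n ih =>
      have := hS.eigenvector_half hsym (by positivity) ih
      rwa [div_div, ← pow_succ] at this
  set h : ℕ → ℝ := fun n => t₀ / 2 ^ n with hh
  have hhpos : ∀ n, 0 < h n := fun n => by positivity
  have hlim : Tendsto h atTop (𝓝 0) := by
    have := (tendsto_pow_atTop_nhds_zero_of_lt_one (r := (1 / 2 : ℝ)) (by norm_num)
      (by norm_num)).const_mul t₀
    simpa [hh, div_eq_mul_inv] using this
  -- Dyadic multiples of `t₀` approaching `t` strictly from the right, hence the `+ 1`: strong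
  -- continuity is available only at `0⁺`, and it is applied to the increments `q n - t > 0`.
  set q : ℕ → ℝ := fun n => ((⌊t / h n⌋₊ + 1 : ℕ) : ℝ) * h n with hq
  have hq1 : ∀ n, t < q n := by
    intro n
    have := Nat.lt_floor_add_one (t / h n)
    rw [div_lt_iff₀ (hhpos n)] at this
    simpa [hq] using this
  have hq2 : ∀ n, q n ≤ t + h n := by
    intro n
    have := Nat.floor_le (div_nonneg ht (hhpos n).le)
    rw [le_div_iff₀ (hhpos n)] at this
    simp only [hq]
    push_cast
    linarith
  have hqlim : Tendsto q atTop (𝓝 t) := by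
    refine tendsto_of_tendsto_of_tendsto_of_le_of_le tendsto_const_nhds ?_
      (fun n => (hq1 n).le) hq2
    simpa using hlim.const_add t
  have h1 : Tendsto (fun n => S (q n) v) atTop (𝓝 (Real.exp (-l * t) • v)) := by
    have : (fun n => S (q n) v) = fun n => Real.exp (-l * q n) • v := by
      funext n
      exact hS.eigenvector_nat_mul (hhpos n) (hdy n) _
    rw [this]
    refine Tendsto.smul_const ?_ v
    exact (Real.continuous_exp.tendsto _).comp (hqlim.const_mul _)
  have h2 : Tendsto (fun n => S (q n) v) atTop (𝓝 (S t v)) := by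
    have heq : (fun n => S (q n) v) = fun n => S (q n - t) (S t v) := by
      funext n
      rw [← mul_apply_eq_comp, ← hS.add _ _ (sub_nonneg.2 (hq1 n).le) ht]
      simp
    rw [heq]
    refine (hS.continuous (S t v)).comp (tendsto_nhdsWithin_iff.2 ⟨?_, ?_⟩)
    · simpa using hqlim.sub_const t
    · exact Eventually.of_forall fun n => sub_pos.2 (hq1 n)
  exact tendsto_nhds_unique h2 h1

/-- A nonzero eigenvector of one operator of a symmetric strongly continuous semigroup has a
positive eigenvalue. -/
theorem IsSemigroupOf.eigenvalue_pos (hS : IsSemigroupOf L S)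
    (hsym : ∀ t, 0 < t → ∀ u v, ⟪S t u, v⟫_ℝ = ⟪u, S t v⟫_ℝ) {t₀ m : ℝ} (ht₀ : 0 < t₀) {v : E}
    (hv0 : v ≠ 0) (hv : S t₀ v = m • v) : 0 < m := by
  have hvn : 0 < ‖v‖ ^ 2 := by positivity
  have hm : m * ‖v‖ ^ 2 = ‖S (t₀ / 2) v‖ ^ 2 := by
    rw [← hS.inner_self_eq hsym ht₀, hv, inner_smul_left, real_inner_self_eq_norm_sq]
    simp
  have hm0 : 0 ≤ m := by
    by_contra! h
    nlinarith [sq_nonneg ‖S (t₀ / 2) v‖]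
  refine lt_of_le_of_ne hm0 fun h0 => hv0 ?_
  subst h0
  -- A zero eigenvalue would propagate to all times `t₀ / 2 ^ n` through `⟪S t v, v⟫ = ‖S (t / 2) v‖
  -- ^ 2`, against strong continuity at `0`.
  have hz : ∀ n : ℕ, S (t₀ / 2 ^ n) v = 0 := by
    intro n
    induction n with
    | zero => simpa using hv
    | succ n ih =>
      have := hS.inner_self_eq hsym (t := t₀ / 2 ^ n) (by positivity) v
      rw [ih, inner_zero_left, div_div, ← pow_succ] at this
      simpa using this.symm
  have hlim : Tendsto (fun n : ℕ => S (t₀ / 2 ^ n) v) atTop (𝓝 v) := by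
    refine (hS.continuous v).comp (tendsto_nhdsWithin_iff.2 ⟨?_, ?_⟩)
    · have := (tendsto_pow_atTop_nhds_zero_of_lt_one (r := (1 / 2 : ℝ)) (by norm_num)
        (by norm_num)).const_mul t₀
      simpa [div_eq_mul_inv] using this
    · exact Eventually.of_forall fun n => by
        show 0 < t₀ / 2 ^ n
        positivity
  simp only [hz] at hlim
  exact (tendsto_nhds_unique hlim tendsto_const_nhds)

/-- A joint eigenvector of the semigroup is an eigenvector of the generator. -/
theorem IsSemigroupOf.mem_graph (hS : IsSemigroupOf L S) {l : ℝ} {v : E}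
    (hv : ∀ t, 0 ≤ t → S t v = Real.exp (-l * t) • v) : (v, l • v) ∈ L.graph := by
  rw [hS.generator]
  have hd : HasDerivAt (fun t : ℝ => -Real.exp (-l * t)) l 0 := by
    have := (((hasDerivAt_id (0 : ℝ)).const_mul (-l)).exp).fun_neg
    simpa using this
  have h1 := hd.tendsto_slope_zero_right
  have h2 := h1.smul_const v
  refine h2.congr' ?_
  filter_upwards [self_mem_nhdsWithin] with t ht
  rw [hv t (le_of_lt ht)]
  simp only [zero_add, mul_zero, Real.exp_zero, smul_eq_mul]
  module

theorem IsSemigroupOf.eigenvector_nonneg (hS : IsSemigroupOf L S)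
    (hLpos : ∀ f : L.domain, 0 ≤ ⟪L f, (f : E)⟫_ℝ) {l : ℝ} {v : E} (hv0 : v ≠ 0)
    (hv : ∀ t, 0 ≤ t → S t v = Real.exp (-l * t) • v) : 0 ≤ l := by
  obtain ⟨y, hy1, hy2⟩ := (LinearPMap.mem_graph_iff _).1 (hS.mem_graph hv)
  have := hLpos y
  simp only at hy1 hy2
  rw [hy2, hy1, inner_smul_left, real_inner_self_eq_norm_sq] at this
  have hvn : 0 < ‖v‖ ^ 2 := by positivity
  by_contra! h
  simp only [conj_trivial] at this
  nlinarith

/-- Eigenvectors of the generator of a symmetric semigroup with distinct eigenvalues are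
orthogonal. -/
theorem IsSemigroupOf.inner_eq_zero (hS : IsSemigroupOf L S)
    (hsym : ∀ t, 0 < t → ∀ u v, ⟪S t u, v⟫_ℝ = ⟪u, S t v⟫_ℝ) {l m : ℝ} (hlm : l ≠ m) {u v : E}
    (hu : (u, l • u) ∈ L.graph) (hv : (v, m • v) ∈ L.graph) : ⟪u, v⟫_ℝ = 0 := by
  rw [hS.generator] at hu hv
  have h1 := Tendsto.inner (𝕜 := ℝ) hu (tendsto_const_nhds (x := v))
  have h2 := Tendsto.inner (𝕜 := ℝ) (tendsto_const_nhds (x := u)) hv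
  have h3 : ⟪l • u, v⟫_ℝ = ⟪u, m • v⟫_ℝ := by
    refine tendsto_nhds_unique h1 (h2.congr' ?_)
    filter_upwards [self_mem_nhdsWithin] with t ht
    rw [inner_smul_left, inner_smul_right, inner_sub_left, inner_sub_right, hsym t ht]
    simp
  rw [inner_smul_left, inner_smul_right] at h3
  have : (l - m) * ⟪u, v⟫_ℝ = 0 := by
    simp only [conj_trivial] at h3
    linarith
  exact (mul_eq_zero.1 this).resolve_left (sub_ne_zero.2 hlm)

/-- The spectral resolution of a symmetric strongly continuous semigroup with nonnegative
generator that contains a compact operator. -/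
theorem IsSemigroupOf.exists_eigenbasis {E : Type u} [NormedAddCommGroup E]
    [InnerProductSpace ℝ E] [CompleteSpace E] {L : E →ₗ.[ℝ] E} {S : ℝ → E →L[ℝ] E}
    (hS : IsSemigroupOf L S) (hsym : ∀ t, 0 < t → ∀ u v, ⟪S t u, v⟫_ℝ = ⟪u, S t v⟫_ℝ)
    (hLpos : ∀ f : L.domain, 0 ≤ ⟪L f, (f : E)⟫_ℝ) {t₀ : ℝ} (ht₀ : 0 < t₀)
    (hc : IsCompactOperator (S t₀)) :
    ∃ (ι : Type u) (b : HilbertBasis ι ℝ E) (l : ι → ℝ), (∀ i, 0 ≤ l i) ∧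
      ∀ i t, 0 ≤ t → S t (b i) = Real.exp (-l i * t) • b i := by
  obtain ⟨ι, b, m, hb⟩ := exists_hilbertBasis_eigenvectors (S t₀) hc (hsym t₀ ht₀)
  have hne : ∀ i, b i ≠ 0 := fun i => b.orthonormal.ne_zero i
  have hm : ∀ i, 0 < m i := fun i => hS.eigenvalue_pos hsym ht₀ (hne i) (hb i)
  have key : ∀ i t, 0 ≤ t → S t (b i) = Real.exp (-(-(Real.log (m i) / t₀)) * t) • b i := by
    intro i t ht
    refine hS.eigenvector_all hsym ht₀ ?_ ht
    rw [neg_neg, div_mul_cancel₀ _ ht₀.ne', Real.exp_log (hm i), hb i]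
  exact ⟨ι, b, _, fun i => hS.eigenvector_nonneg hLpos (hne i) (key i), key⟩

end Semigroup

/-! ### The semigroup in eigenbasis coordinates -/

section Eigenbasis

variable {E : Type*} [NormedAddCommGroup E] [InnerProductSpace ℝ E] {S : ℝ → E →L[ℝ] E}
  {ι : Type*} {b : HilbertBasis ι ℝ E} {l : ι → ℝ}

theorem inner_basis_semigroup (hsym : ∀ t, 0 < t → ∀ u v, ⟪S t u, v⟫_ℝ = ⟪u, S t v⟫_ℝ)
    (hb : ∀ i t, 0 ≤ t → S t (b i) = Real.exp (-l i * t) • b i) {t : ℝ} (ht : 0 < t) (v : E)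
    (i : ι) : ⟪b i, S t v⟫_ℝ = Real.exp (-l i * t) * ⟪b i, v⟫_ℝ := by
  rw [← hsym t ht, hb i t ht.le, inner_smul_left]
  simp

theorem hasSum_inner_sq (b : HilbertBasis ι ℝ E) (v : E) :
    HasSum (fun i => ⟪b i, v⟫_ℝ ^ 2) (‖v‖ ^ 2) := by
  have := b.hasSum_inner_mul_inner v v
  rw [real_inner_self_eq_norm_sq] at this
  refine this.congr_fun fun i => ?_
  rw [real_inner_comm v, sq]

theorem hasSum_inner_semigroup (hsym : ∀ t, 0 < t → ∀ u v, ⟪S t u, v⟫_ℝ = ⟪u, S t v⟫_ℝ)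
    (hb : ∀ i t, 0 ≤ t → S t (b i) = Real.exp (-l i * t) • b i) {t : ℝ} (ht : 0 < t) (v : E) :
    HasSum (fun i => Real.exp (-l i * t) * ⟪b i, v⟫_ℝ ^ 2) ⟪S t v, v⟫_ℝ := by
  refine (b.hasSum_inner_mul_inner (S t v) v).congr_fun fun i => ?_
  rw [real_inner_comm (b i) (S t v), inner_basis_semigroup hsym hb ht]
  ring

theorem norm_semigroup_le (hsym : ∀ t, 0 < t → ∀ u v, ⟪S t u, v⟫_ℝ = ⟪u, S t v⟫_ℝ)
    (hb : ∀ i t, 0 ≤ t → S t (b i) = Real.exp (-l i * t) • b i) (hl : ∀ i, 0 ≤ l i) {t : ℝ}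
    (ht : 0 < t) (v : E) : ‖S t v‖ ≤ ‖v‖ := by
  refine le_of_sq_le_sq ?_ (norm_nonneg v)
  refine hasSum_le (fun i => ?_) (hasSum_inner_sq b (S t v)) (hasSum_inner_sq b v)
  rw [inner_basis_semigroup hsym hb ht, mul_pow]
  refine mul_le_of_le_one_left (sq_nonneg _) ?_
  refine pow_le_one₀ (Real.exp_pos _).le (Real.exp_le_one_iff.2 ?_)
  nlinarith [hl i]

/-- If `⟪v - S t v, v⟫ = o(t)` then `v` is invariant under the semigroup. -/
theorem semigroup_eq_self (hsym : ∀ t, 0 < t → ∀ u v, ⟪S t u, v⟫_ℝ = ⟪u, S t v⟫_ℝ)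
    (hb : ∀ i t, 0 ≤ t → S t (b i) = Real.exp (-l i * t) • b i) (hl : ∀ i, 0 ≤ l i) {v : E}
    (hv : Tendsto (fun t => t⁻¹ * ⟪v - S t v, v⟫_ℝ) (𝓝[>] 0) (𝓝 0)) {t : ℝ} (ht : 0 < t) :
    S t v = v := by
  -- In coordinates `t⁻¹ * ⟪v - S t v, v⟫` is a series of nonnegative terms `t⁻¹ (1 - exp (-l i t))
  -- ⟪b i, v⟫ ^ 2`. It dominates each of them, and the `i`-th tends to `l i * ⟪b i, v⟫ ^ 2`.
  have key : ∀ i, l i * ⟪b i, v⟫_ℝ ^ 2 = 0 := by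
    intro i
    have hd : HasDerivAt (fun t : ℝ => -Real.exp (-l i * t)) (l i) 0 := by
      have := (((hasDerivAt_id (0 : ℝ)).const_mul (-l i)).exp).fun_neg
      simpa using this
    have h1 := hd.tendsto_slope_zero_right.mul_const (⟪b i, v⟫_ℝ ^ 2)
    refine le_antisymm (le_of_tendsto_of_tendsto h1 hv ?_)
      (mul_nonneg (hl i) (sq_nonneg _))
    filter_upwards [self_mem_nhdsWithin] with t ht
    have ht' : (0 : ℝ) < t := ht
    have hs := (hasSum_inner_sq b v).sub (hasSum_inner_semigroup hsym hb ht' v)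
    rw [← real_inner_self_eq_norm_sq, ← inner_sub_left] at hs
    have hle := le_hasSum hs i fun j _ => by
      have : Real.exp (-l j * t) ≤ 1 := Real.exp_le_one_iff.2 (by nlinarith [hl j])
      nlinarith [sq_nonneg ⟪b j, v⟫_ℝ]
    simp only [zero_add, mul_zero, Real.exp_zero, smul_eq_mul]
    rw [mul_assoc]
    refine mul_le_mul_of_nonneg_left (le_trans (le_of_eq ?_) hle) (by positivity)
    ring
  refine (b.repr.injective (lp.ext (funext fun i => ?_)))
  rw [b.repr_apply_apply, b.repr_apply_apply, inner_basis_semigroup hsym hb ht]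
  rcases mul_eq_zero.1 (key i) with h | h
  · simp [h]
  · simp [pow_eq_zero_iff] at h
    simp [h]

end Eigenbasis

/-! ### Volume growth: doubling, null accumulation points, reverse doubling -/

section Doubling

variable {M : Type*} [MetricSpace M] [MeasurableSpace M] {μ : Measure M}

/-- The doubling property with an integral exponent, in terms of the real-valued measure. -/
def DoublingExp (μ : Measure M) (N : ℕ) : Prop :=
  ∀ (x : M) (r : ℝ), 0 < r → 0 < μ.real (Metric.ball x r) ∧
    μ.real (Metric.ball x (2 * r)) ≤ 2 ^ N * μ.real (Metric.ball x r)

theorem Doubling.exists_doublingExp [IsFiniteMeasure μ] (hμ : Doubling μ) :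
    ∃ N : ℕ, DoublingExp μ N := by
  obtain ⟨D, hD, h⟩ := hμ
  obtain ⟨N, hN⟩ := exists_nat_ge D
  refine ⟨N, fun x r hr => ⟨?_, ?_⟩⟩
  · have := (h x (r / 2) (by positivity)).1
    rw [mul_div_cancel₀ _ two_ne_zero] at this
    exact ENNReal.toReal_pos this.ne' (measure_ne_top _ _)
  · have h2 := ENNReal.toReal_mono
      (ENNReal.mul_ne_top ENNReal.ofReal_ne_top (measure_ne_top _ _)) (h x r hr).2
    rw [ENNReal.toReal_mul, ENNReal.toReal_ofReal (by positivity)] at h2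
    refine h2.trans (mul_le_mul_of_nonneg_right ?_ ENNReal.toReal_nonneg)
    rw [← Real.rpow_natCast]
    exact Real.rpow_le_rpow_of_exponent_le (by norm_num) hN

namespace DoublingExp

variable {N : ℕ}

theorem pos (h : DoublingExp μ N) (x : M) {r : ℝ} (hr : 0 < r) : 0 < μ.real (Metric.ball x r) :=
  (h x r hr).1

theorem measureReal_pow_mul_le (h : DoublingExp μ N) (x : M) {r : ℝ} (hr : 0 < r) (k : ℕ) :
    μ.real (Metric.ball x (2 ^ k * r)) ≤ (2 ^ N) ^ k * μ.real (Metric.ball x r) := by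
  induction k with
  | zero => simp
  | succ k ih =>
    have := (h x (2 ^ k * r) (by positivity)).2
    rw [← mul_assoc, ← pow_succ'] at this
    refine this.trans ?_
    rw [pow_succ' (2 ^ N), mul_assoc]
    gcongr

variable [IsFiniteMeasure μ]

theorem compare (h : DoublingExp μ N) {x y : M} {r : ℝ} (hr : 0 < r) {k : ℕ}
    (hxy : dist x y ≤ 2 ^ k * r) :
    μ.real (Metric.ball x r) ≤ (2 ^ N) ^ (k + 1) * μ.real (Metric.ball y r) := by
  refine le_trans (measureReal_mono (Metric.ball_subset_ball' ?_)) (h.measureReal_pow_mul_le y hr (k + 1))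
  have : (1 : ℝ) ≤ 2 ^ k := one_le_pow₀ (by norm_num)
  rw [pow_succ]
  nlinarith

/-- About `log₂ (1 / r)` doublings bring the radius above `1`, and `k₀` further ones cover `M`. The
first group costs a factor of order `r ^ (-N)`, the second a constant. -/
theorem exists_lower_bound [CompactSpace M] [Nonempty M] (h : DoublingExp μ N) :
    ∃ c : ℝ, 0 < c ∧ ∀ (x : M) (r : ℝ), 0 < r → r ≤ 1 → c * r ^ N ≤ μ.real (Metric.ball x r) := by
  obtain ⟨k₀, hk₀⟩ := pow_unbounded_of_one_lt (Metric.diam (univ : Set M)) (one_lt_two (α := ℝ))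
  have huniv : ∀ (x : M) (r : ℝ), 2 ^ k₀ ≤ r → Metric.ball x r = univ := by
    intro x r hr
    refine eq_univ_of_forall fun y => ?_
    rw [Metric.mem_ball]
    exact ((Metric.dist_le_diam_of_mem isCompact_univ.isBounded (mem_univ y)
      (mem_univ x)).trans_lt hk₀).trans_le hr
  obtain ⟨x₀⟩ := ‹Nonempty M›
  have hpos : 0 < μ.real (univ : Set M) := by
    rw [← huniv x₀ _ le_rfl]
    exact h.pos x₀ (by positivity)
  refine ⟨μ.real univ / (2 ^ N) ^ (k₀ + 1), by positivity, fun x r hr hr1 => ?_⟩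
  obtain ⟨k, hk1, hk2⟩ := exists_nat_pow_near_of_lt_one hr hr1
    (by norm_num : (0 : ℝ) < 1 / 2) (by norm_num : (1 / 2 : ℝ) < 1)
  have h1 := h.measureReal_pow_mul_le x hr (k₀ + (k + 1))
  rw [huniv] at h1
  · rw [div_mul_eq_mul_div, div_le_iff₀ (by positivity)]
    have h2 : r ^ N * (2 ^ N) ^ k ≤ 1 := by
      rw [← pow_mul, mul_comm N, pow_mul, ← mul_pow]
      refine pow_le_one₀ (by positivity) ?_
      calc r * 2 ^ k ≤ (1 / 2) ^ k * 2 ^ k := by gcongr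
        _ = 1 := by rw [← mul_pow]; norm_num
    calc μ.real univ * r ^ N
        ≤ ((2 ^ N) ^ (k₀ + (k + 1)) * μ.real (Metric.ball x r)) * r ^ N := by gcongr
      _ = (r ^ N * (2 ^ N) ^ k) * (μ.real (Metric.ball x r) * (2 ^ N) ^ (k₀ + 1)) := by ring
      _ ≤ 1 * (μ.real (Metric.ball x r) * (2 ^ N) ^ (k₀ + 1)) := by gcongr
      _ = _ := one_mul _
  · rw [pow_add, mul_assoc]
    refine le_mul_of_one_le_right (by positivity) ?_
    calc (1 : ℝ) = 2 ^ (k + 1) * (1 / 2) ^ (k + 1) := by rw [← mul_pow]; norm_num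
      _ ≤ 2 ^ (k + 1) * r := by gcongr

/-- In an infinite compact doubling space there is a point whose small balls have small measure. -/
theorem exists_tendsto_zero [BorelSpace M] [CompactSpace M] [Infinite M] (h : DoublingExp μ N) :
    ∃ x : M, Tendsto (fun r => μ.real (Metric.ball x r)) (𝓝[>] 0) (𝓝 0) := by
  obtain ⟨x, hx⟩ := (infinite_univ (α := M)).exists_accPt_principal
  refine ⟨x, ?_⟩
  have hint : ⋂ r > (0 : ℝ), Metric.ball x r = {x} := by
    ext y
    simp only [mem_iInter, Metric.mem_ball, mem_singleton_iff]
    refine ⟨fun hy => ?_, fun hy r hr => by simpa [hy] using hr⟩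
    by_contra hne
    exact lt_irrefl _ (hy _ (dist_pos.2 hne))
  have hlim : Tendsto (fun r => μ.real (Metric.ball x r)) (𝓝[>] 0) (𝓝 (μ.real {x})) := by
    have := tendsto_measure_biInter_gt (μ := μ) (s := Metric.ball x) (a := (0 : ℝ))
      (fun r _ => Metric.isOpen_ball.measurableSet.nullMeasurableSet)
      (fun i j _ hij => Metric.ball_subset_ball hij) ⟨1, one_pos, measure_ne_top _ _⟩
    rw [hint] at this
    exact (ENNReal.tendsto_toReal (measure_ne_top _ _)).comp this
  -- If `x` were an atom, small balls at `x` would have hardly more mass than `{x}`. But for `y ≠ x`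
  -- near `x`, the ball `B(y, d / 2)` with `d = dist y x` misses `x`, and two doublings of it
  -- contain `x`, so it carries at least the fraction `(2 ^ N) ^ (-2)` of the atom.
  have hzero : μ.real {x} = 0 := by
    by_contra hne
    have hpos : 0 < μ.real {x} := lt_of_le_of_ne measureReal_nonneg (Ne.symm hne)
    have hev : ∀ᶠ r in 𝓝[>] (0 : ℝ),
        μ.real (Metric.ball x r) < μ.real {x} + μ.real {x} / (2 ^ N) ^ 2 :=
      hlim.eventually (gt_mem_nhds (by simp; positivity))
    obtain ⟨u, hu, hu'⟩ := mem_nhdsGT_iff_exists_Ioc_subset.1 hev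
    have hu0 : (0 : ℝ) < u := hu
    obtain ⟨y, ⟨hyu, -⟩, hyx⟩ := (accPt_iff_nhds.1 hx) _ (Metric.ball_mem_nhds x (half_pos hu0))
    have hd : 0 < dist y x := dist_pos.2 hyx
    rw [Metric.mem_ball] at hyu
    have h1 : μ.real {x} ≤ (2 ^ N) ^ 2 * μ.real (Metric.ball y (dist y x / 2)) := by
      refine le_trans (measureReal_mono ?_) (h.measureReal_pow_mul_le y (half_pos hd) 2)
      rw [singleton_subset_iff, Metric.mem_ball, dist_comm]
      linarith
    have h2 : μ.real {x} + μ.real (Metric.ball y (dist y x / 2)) ≤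
        μ.real (Metric.ball x (2 * dist y x)) := by
      rw [← measureReal_union _ Metric.isOpen_ball.measurableSet]
      · refine measureReal_mono (union_subset ?_ (Metric.ball_subset_ball' ?_))
        · rw [singleton_subset_iff]
          exact Metric.mem_ball_self (by positivity)
        · linarith
      · rw [disjoint_singleton_left, Metric.mem_ball, dist_comm, not_lt]
        linarith
    have h3 : μ.real (Metric.ball x (2 * dist y x)) < μ.real {x} + μ.real {x} / (2 ^ N) ^ 2 :=
      hu' ⟨by positivity, by linarith⟩
    have h4 : μ.real {x} / (2 ^ N) ^ 2 ≤ μ.real (Metric.ball y (dist y x / 2)) := by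
      rw [div_le_iff₀ (by positivity), mul_comm]
      exact h1
    linarith
  rwa [hzero] at hlim

/-- Reverse doubling at a point all of whose small dyadic annuli are nonempty. -/
theorem exists_reverse [BorelSpace M] (h : DoublingExp μ N) {x : M} {r₀ : ℝ}
    (hx : ∀ r, 0 < r → r < r₀ → ∃ y, r ≤ dist y x ∧ dist y x < 2 * r) (K : ℝ) :
    ∃ k : ℕ, ∀ r, 0 < r → 8 ^ k * r < r₀ →
      K * μ.real (Metric.ball x r) < μ.real (Metric.ball x (8 ^ k * r)) := by
  set δ : ℝ := ((2 ^ N) ^ 3)⁻¹ with hδ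
  have hδ0 : 0 < δ := by positivity
  -- A point `y` with `2r ≤ dist y x < 4r` gives disjoint balls `B(x, r)` and `B(y, r)` inside `B(x,
  -- 8r)`; by doubling the second has at least the fraction `δ` of the volume of the first.
  have step : ∀ r, 0 < r → 8 * r < r₀ →
      (1 + δ) * μ.real (Metric.ball x r) ≤ μ.real (Metric.ball x (8 * r)) := by
    intro r hr hr8
    obtain ⟨y, hy1, hy2⟩ := hx (2 * r) (by linarith) (by linarith)
    have h1 : μ.real (Metric.ball x r) ≤ (2 ^ N) ^ 3 * μ.real (Metric.ball y r) := by
      refine h.compare hr ?_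
      rw [dist_comm]
      linarith
    have h2 : μ.real (Metric.ball x r) + μ.real (Metric.ball y r) ≤
        μ.real (Metric.ball x (8 * r)) := by
      rw [← measureReal_union _ Metric.isOpen_ball.measurableSet]
      · refine measureReal_mono (union_subset (Metric.ball_subset_ball (by linarith))
          (Metric.ball_subset_ball' (by linarith)))
      · refine Metric.ball_disjoint_ball ?_
        rw [dist_comm]
        linarith
    have h3 : δ * μ.real (Metric.ball x r) ≤ μ.real (Metric.ball y r) := by
      rw [hδ, inv_mul_le_iff₀ (by positivity)]
      exact h1
    linarith
  have iter : ∀ k r, 0 < r → 8 ^ k * r < r₀ →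
      (1 + δ) ^ k * μ.real (Metric.ball x r) ≤ μ.real (Metric.ball x (8 ^ k * r)) := by
    intro k
    induction k with
    | zero => intro r _ _; simp
    | succ k ih =>
      intro r hr hk
      have h8 : (8 : ℝ) ^ (k + 1) * r = 8 * (8 ^ k * r) := by ring
      rw [h8] at hk ⊢
      have hp : 0 < 8 ^ k * r := by positivity
      calc (1 + δ) ^ (k + 1) * μ.real (Metric.ball x r)
          = (1 + δ) * ((1 + δ) ^ k * μ.real (Metric.ball x r)) := by ring
        _ ≤ (1 + δ) * μ.real (Metric.ball x (8 ^ k * r)) := by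
          gcongr
          exact ih r hr (by linarith)
        _ ≤ _ := step _ hp hk
  obtain ⟨k, hk⟩ := pow_unbounded_of_one_lt K (show 1 < 1 + δ by linarith)
  refine ⟨k, fun r hr hkr => lt_of_lt_of_le ?_ (iter k r hr hkr)⟩
  exact mul_lt_mul_of_pos_right hk (h.pos x hr)

end DoublingExp

end Doubling

/-! ### Pointwise heat kernel estimates -/

section KernelBounds

variable {M : Type*} [MetricSpace M] [CompactSpace M] [Nonempty M] [MeasurableSpace M]
  [BorelSpace M] {μ : Measure M} [IsFiniteMeasure μ] {N : ℕ}

theorem exp_neg_le {z : ℝ} (hz : 0 < z) (m : ℕ) : Real.exp (-z) ≤ m.factorial / z ^ m := by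
  have h := Real.pow_div_factorial_le_exp z hz.le m
  rw [Real.exp_neg, ← inv_div]
  exact inv_anti₀ (by positivity) h

/-- Global bounds for the Gaussian factor away from the diagonal. -/
theorem DoublingExp.exists_gaussianFactor_le (hN : DoublingExp μ N) {C c : ℝ} (hC : 0 < C)
    (hc : 0 < c) : ∃ a : ℝ, 0 < a ∧ ∀ t, 0 < t → t < 1 → ∀ (δ : ℝ) (x y : M), 0 ≤ δ →
      δ ≤ dist x y → gaussianFactor μ C c t x y ≤ C / (a * √t ^ N) * Real.exp (-(c * δ ^ 2 / t)) := by
  obtain ⟨a, ha, h⟩ := hN.exists_lower_bound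
  refine ⟨a, ha, fun t ht ht1 δ x y hδ hxy => ?_⟩
  have hst : 0 < √t := Real.sqrt_pos.2 ht
  have hst1 : √t ≤ 1 := Real.sqrt_le_one.2 ht1.le
  have hx := h x √t hst hst1
  have hy := h y √t hst hst1
  have hp : 0 < a * √t ^ N := by positivity
  unfold gaussianFactor
  refine mul_le_mul ?_ ?_ (Real.exp_pos _).le (by positivity)
  · refine div_le_div_of_nonneg_left hC.le hp (Real.le_sqrt_of_sq_le ?_)
    rw [sq]
    exact mul_le_mul hx hy hp.le (hp.le.trans hx)
  · refine Real.exp_le_exp.2 ?_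
    rw [neg_mul, neg_div, neg_le_neg_iff]
    gcongr

/-- Of the `N + 2` powers of `t` extracted from the Gaussian, `N` absorb the volume factor. The
remaining `t ^ 2` is `o(t)`, which is what the criterion `semigroup_eq_self` requires. -/
theorem exists_far_bound (hN : DoublingExp μ N) {P : ℝ → M → M → ℝ} (hG : GaussianBounds μ P)
    {δ : ℝ} (hδ : 0 < δ) : ∃ A : ℝ, 0 < A ∧ ∀ t, 0 < t → t < 1 → ∀ x y, δ ≤ dist x y →
      P t x y ≤ A * t ^ 2 := by
  obtain ⟨C, c, α, hC, hc, hα, h⟩ := hG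
  obtain ⟨a, ha, hg⟩ := hN.exists_gaussianFactor_le hC hc
  refine ⟨C / a * ((N + 2).factorial / (c * δ ^ 2) ^ (N + 2)), by positivity,
    fun t ht ht1 x y hxy => ?_⟩
  refine ((h t ht ht1).1 x y).trans ((hg t ht ht1 δ x y hδ.le hxy).trans ?_)
  have hst : t ≤ √t := by
    refine Real.le_sqrt_of_sq_le ?_
    rw [sq]
    exact mul_le_of_le_one_left ht.le ht1.le
  calc C / (a * √t ^ N) * Real.exp (-(c * δ ^ 2 / t))
      ≤ C / (a * t ^ N) * ((N + 2).factorial / (c * δ ^ 2 / t) ^ (N + 2)) := by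
        gcongr
        exact exp_neg_le (by positivity) _
    _ = C / a * ((N + 2).factorial / (c * δ ^ 2) ^ (N + 2)) * t ^ 2 := by
        rw [div_pow (c * δ ^ 2) t, pow_add t]
        field_simp

theorem IsHeatKernel.integrable {S : ℝ → Lp ℝ 2 μ →L[ℝ] Lp ℝ 2 μ} {P : ℝ → M → M → ℝ}
    (hP : IsHeatKernel μ S P) {t : ℝ} (ht : 0 < t) (x : M) : Integrable (P t x) μ := by
  by_contra h
  have := hP.mass t ht x
  rw [integral_undef h] at this
  exact zero_ne_one this

/-- For `t ≥ 1` no Gaussian bound is assumed; `P t` is then an average of `P (1 / 2)` against the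
probability density `P (t - 1 / 2)`. -/
theorem IsHeatKernel.exists_bound {S : ℝ → Lp ℝ 2 μ →L[ℝ] Lp ℝ 2 μ} {P : ℝ → M → M → ℝ}
    (hP : IsHeatKernel μ S P) (hN : DoublingExp μ N) (hG : GaussianBounds μ P) {t : ℝ}
    (ht : 0 < t) : ∃ C : ℝ, 0 < C ∧ ∀ x y, P t x y ≤ C := by
  have small : ∀ t, 0 < t → t < 1 → ∃ C : ℝ, 0 < C ∧ ∀ x y, P t x y ≤ C := by
    intro t ht ht1
    obtain ⟨C, c, α, hC, hc, hα, h⟩ := hG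
    obtain ⟨a, ha, hg⟩ := hN.exists_gaussianFactor_le hC hc
    have hst : 0 < √t := Real.sqrt_pos.2 ht
    refine ⟨C / (a * √t ^ N), by positivity, fun x y => ((h t ht ht1).1 x y).trans ?_⟩
    simpa using hg t ht ht1 0 x y le_rfl dist_nonneg
  rcases lt_or_ge t 1 with ht1 | ht1
  · exact small t ht ht1
  · obtain ⟨C, hC, h⟩ := small (1 / 2) (by norm_num) (by norm_num)
    refine ⟨C, hC, fun x y => ?_⟩
    have h2 : 0 < t - 1 / 2 := by linarith
    obtain ⟨h3, h4⟩ := hP.chapman (1 / 2) (t - 1 / 2) (by norm_num) h2 x y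
    rw [add_sub_cancel] at h4
    rw [h4]
    have h5 : Integrable (fun u => P (t - 1 / 2) u y) μ := by
      simpa only [hP.symm _ h2 _ y] using hP.integrable h2 y
    calc ∫ u, P (1 / 2) x u * P (t - 1 / 2) u y ∂μ
        ≤ ∫ u, C * P (t - 1 / 2) u y ∂μ := by
          refine integral_mono h3 (h5.const_mul C) fun u => ?_
          exact mul_le_mul_of_nonneg_right (h x u) (hP.nonneg _ h2 _ _)
      _ = C := by
          rw [integral_const_mul]
          simp only [hP.symm _ h2 _ y, hP.mass _ h2, mul_one]

/-- Decay of the heat kernel on dyadic annuli, normalised at the first point. -/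
theorem exists_annulus_bound (hN : DoublingExp μ N) {P : ℝ → M → M → ℝ}
    (hG : GaussianBounds μ P) : ∃ A : ℝ, 0 < A ∧ ∀ t, 0 < t → t < 1 → ∀ (x y : M) (n : ℕ),
      2 ^ n * √t ≤ dist x y → dist x y < 2 ^ (n + 1) * √t →
      P t x y ≤ A * ((2 ^ (N + 1))⁻¹) ^ n / μ.real (Metric.ball x √t) := by
  obtain ⟨C, c, α, hC, hc, hα, h⟩ := hG
  refine ⟨C * (2 ^ N) ^ 2 * ((N + 1).factorial / c ^ (N + 1)), by positivity,
    fun t ht ht1 x y n hn1 hn2 => ?_⟩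
  have hst : 0 < √t := Real.sqrt_pos.2 ht
  refine ((h t ht ht1).1 x y).trans ?_
  have hx := hN.pos x hst
  have hy := hN.pos y hst
  have hcmp := hN.compare hst hn2.le
  have hQ : (1 : ℝ) ≤ (2 ^ N) ^ (n + 1 + 1) := one_le_pow₀ (one_le_pow₀ (by norm_num))
  set Q : ℝ := (2 ^ N) ^ (n + 1 + 1) with hQdef
  have hsq : μ.real (Metric.ball x √t) / Q ≤
      √(μ.real (Metric.ball x √t) * μ.real (Metric.ball y √t)) := by
    refine Real.le_sqrt_of_sq_le ?_
    rw [div_pow, sq, sq, div_le_iff₀ (by positivity)]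
    calc μ.real (Metric.ball x √t) * μ.real (Metric.ball x √t)
        ≤ μ.real (Metric.ball x √t) * (Q * μ.real (Metric.ball y √t)) := by gcongr
      _ = μ.real (Metric.ball x √t) * μ.real (Metric.ball y √t) * Q := by ring
      _ ≤ μ.real (Metric.ball x √t) * μ.real (Metric.ball y √t) * (Q * Q) := by
        gcongr
        nlinarith
  -- The exponent `N + 1` is large enough to pay for `Q`, of order `2 ^ (N n)`, and to leave the
  -- decay `2 ^ (-(N + 1) n)`; the latter beats the volume of the `n`-th annulus by `2 ^ (-n)`.
  have hexp : Real.exp (-c * dist x y ^ 2 / t) ≤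
      (N + 1).factorial / c ^ (N + 1) * ((4 ^ n) ^ (N + 1))⁻¹ := by
    have h1 : c * 4 ^ n ≤ c * dist x y ^ 2 / t := by
      rw [le_div_iff₀ ht]
      have : (2 ^ n * √t) ^ 2 ≤ dist x y ^ 2 := by gcongr
      rw [mul_pow, Real.sq_sqrt ht.le, ← pow_mul, mul_comm n, pow_mul] at this
      norm_num at this
      rw [mul_assoc]
      gcongr
    calc Real.exp (-c * dist x y ^ 2 / t) ≤ Real.exp (-(c * 4 ^ n)) := by
          refine Real.exp_le_exp.2 ?_
          rw [neg_mul, neg_div]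
          linarith
      _ ≤ (N + 1).factorial / (c * 4 ^ n) ^ (N + 1) := exp_neg_le (by positivity) _
      _ = _ := by rw [mul_pow, div_mul_eq_div_div, div_eq_mul_inv (_ / _)]
  unfold gaussianFactor
  calc C / √(μ.real (Metric.ball x √t) * μ.real (Metric.ball y √t)) *
        Real.exp (-c * dist x y ^ 2 / t)
      ≤ C / (μ.real (Metric.ball x √t) / Q) *
        ((N + 1).factorial / c ^ (N + 1) * ((4 ^ n) ^ (N + 1))⁻¹) := by gcongr
    _ = C * (2 ^ N) ^ 2 * ((N + 1).factorial / c ^ (N + 1)) * ((2 ^ N) ^ n * ((4 ^ n) ^ (N + 1))⁻¹)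
        / μ.real (Metric.ball x √t) := by
        rw [hQdef]
        field_simp
        ring
    _ ≤ _ := by
        gcongr
        rw [← div_eq_mul_inv, div_le_iff₀ (by positivity), inv_pow, inv_mul_eq_div,
          le_div_iff₀ (by positivity)]
        have : ((4 : ℝ) ^ n) ^ (N + 1) = ((2 ^ N) ^ n * (2 ^ (N + 1)) ^ n) * 2 ^ n := by
          rw [show (4 : ℝ) = 2 ^ 2 by norm_num]
          simp only [← pow_mul, ← pow_add]
          congr 1
          ring
        rw [this]
        exact le_mul_of_one_le_right (by positivity) (one_le_pow₀ (by norm_num))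

theorem exists_diag_upper {P : ℝ → M → M → ℝ}
    (hG : GaussianBounds μ P) : ∃ C : ℝ, 0 < C ∧ ∀ t, 0 < t → t < 1 → ∀ x : M,
      P t x x ≤ C / μ.real (Metric.ball x √t) := by
  obtain ⟨C, c, α, hC, hc, hα, h⟩ := hG
  refine ⟨C, hC, fun t ht ht1 x => ((h t ht ht1).1 x x).trans (le_of_eq ?_)⟩
  simp [gaussianFactor, Real.sqrt_mul_self measureReal_nonneg]

/-- Half of the mass of the heat kernel lies in a ball of radius comparable to `√t`. -/
theorem IsHeatKernel.exists_half_mass {S : ℝ → Lp ℝ 2 μ →L[ℝ] Lp ℝ 2 μ} {P : ℝ → M → M → ℝ}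
    (hP : IsHeatKernel μ S P) (hN : DoublingExp μ N) (hG : GaussianBounds μ P) :
    ∃ n : ℕ, ∀ t, 0 < t → t < 1 → ∀ x : M,
      1 / 2 ≤ ∫ y in Metric.ball x (2 ^ n * √t), P t x y ∂μ := by
  obtain ⟨A, hA, h⟩ := exists_annulus_bound hN hG
  -- The annuli from index `n` on carry mass at most `2 * A * 2 ^ N * 2 ^ (-n)`, which this `n`
  -- makes at most `1 / 2`.
  obtain ⟨n, hn⟩ := pow_unbounded_of_one_lt (4 * (A * 2 ^ N)) (one_lt_two (α := ℝ))
  refine ⟨n, fun t ht ht1 x => ?_⟩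
  have hst : 0 < √t := Real.sqrt_pos.2 ht
  have hball := hN.pos x hst
  have hint := hP.integrable ht x
  set B : ℕ → Set M := fun k => Metric.ball x (2 ^ k * √t) with hB
  have hann : ∀ k, ∫ y in B (k + 1) \ B k, P t x y ∂μ ≤ A * 2 ^ N * (1 / 2) ^ k := by
    intro k
    have hmeas : MeasurableSet (B (k + 1) \ B k) :=
      Metric.isOpen_ball.measurableSet.diff Metric.isOpen_ball.measurableSet
    calc ∫ y in B (k + 1) \ B k, P t x y ∂μ
        ≤ ∫ _ in B (k + 1) \ B k,
          A * ((2 ^ (N + 1))⁻¹) ^ k / μ.real (Metric.ball x √t) ∂μ := by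
          refine setIntegral_mono_on hint.integrableOn (integrable_const _).integrableOn hmeas ?_
          rintro y ⟨hy1, hy2⟩
          simp only [hB, Metric.mem_ball, not_lt, dist_comm y x] at hy1 hy2
          exact h t ht ht1 x y k hy2 hy1
      _ = μ.real (B (k + 1) \ B k) * (A * ((2 ^ (N + 1))⁻¹) ^ k / μ.real (Metric.ball x √t)) := by
          rw [setIntegral_const, smul_eq_mul]
      _ ≤ ((2 ^ N) ^ (k + 1) * μ.real (Metric.ball x √t)) *
          (A * ((2 ^ (N + 1))⁻¹) ^ k / μ.real (Metric.ball x √t)) := by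
          gcongr
          exact (measureReal_mono sdiff_subset).trans (hN.measureReal_pow_mul_le x hst _)
      _ = A * 2 ^ N * (2 ^ N * (2 ^ (N + 1))⁻¹) ^ k := by
          rw [mul_pow]
          field_simp
          ring
      _ = A * 2 ^ N * (1 / 2) ^ k := by
          congr 2
          rw [pow_succ]
          field_simp
  have hsum : ∀ m, ∫ y in B (n + m) \ B n, P t x y ∂μ ≤
      A * 2 ^ N * (1 / 2) ^ n * (2 - 2 * (1 / 2) ^ m) := by
    intro m
    induction m with
    | zero => simp
    | succ m ih =>
      have hmono : ∀ {i j}, i ≤ j → B i ⊆ B j := fun {i j} hij =>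
        Metric.ball_subset_ball (by gcongr; norm_num)
      have hun : B (n + (m + 1)) \ B n = (B (n + m) \ B n) ∪ (B (n + m + 1) \ B (n + m)) := by
        ext y
        have h1 := @hmono n (n + m) (by omega) y
        have h2 := @hmono (n + m) (n + m + 1) (by omega) y
        simp only [Set.mem_sdiff, mem_union, ← add_assoc]
        tauto
      rw [hun, setIntegral_union _ _ hint.integrableOn hint.integrableOn]
      · refine (add_le_add ih (hann (n + m))).trans (le_of_eq ?_)
        rw [pow_add, pow_succ]
        ring
      · refine Set.disjoint_left.2 fun y hy1 hy2 => hy2.2 hy1.1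
      · exact Metric.isOpen_ball.measurableSet.diff Metric.isOpen_ball.measurableSet
  obtain ⟨m, hm⟩ := pow_unbounded_of_one_lt (Metric.diam (univ : Set M) / √t)
    (one_lt_two (α := ℝ))
  have huniv : B (n + m) = univ := by
    refine eq_univ_of_forall fun y => ?_
    simp only [hB, Metric.mem_ball]
    refine (Metric.dist_le_diam_of_mem isCompact_univ.isBounded (mem_univ y)
      (mem_univ x)).trans_lt ?_
    rw [div_lt_iff₀ hst] at hm
    refine hm.trans_le ?_
    gcongr
    · norm_num
    · omega
  have htail := hsum m
  rw [huniv, ← compl_eq_univ_sdiff] at htail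
  have htot := integral_add_compl (μ := μ) (s := B n) Metric.isOpen_ball.measurableSet hint
  rw [hP.mass t ht x] at htot
  have hsmall : A * 2 ^ N * (1 / 2) ^ n * (2 - 2 * (1 / 2) ^ m) ≤ 1 / 2 := by
    have h1 : A * 2 ^ N * (1 / 2) ^ n ≤ 1 / 4 := by
      rw [div_pow, one_pow, mul_one_div, div_le_iff₀ (by positivity)]
      linarith
    have h2 : (0 : ℝ) < (1 / 2) ^ m := by positivity
    nlinarith [show 0 < A * 2 ^ N * (1 / 2) ^ n by positivity]
  linarith

/-- `P (t + t) x x = ∫ P t x u ^ 2`, and Cauchy–Schwarz on a ball `B` with half of the mass bounds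
this below by `1 / (4 |B|)`. Cauchy–Schwarz enters as `2 a p - a ^ 2 ≤ p ^ 2` with the optimal `a =
1 / (2 |B|)`. -/
theorem IsHeatKernel.exists_diag_lower {S : ℝ → Lp ℝ 2 μ →L[ℝ] Lp ℝ 2 μ} {P : ℝ → M → M → ℝ}
    (hP : IsHeatKernel μ S P) (hN : DoublingExp μ N) (hG : GaussianBounds μ P) :
    ∃ c : ℝ, 0 < c ∧ ∀ t, 0 < t → t < 1 → ∀ x : M,
      c / μ.real (Metric.ball x √t) ≤ P (t + t) x x := by
  obtain ⟨n, hn⟩ := hP.exists_half_mass hN hG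
  refine ⟨1 / (4 * (2 ^ N) ^ n), by positivity, fun t ht ht1 x => ?_⟩
  have hst : 0 < √t := Real.sqrt_pos.2 ht
  obtain ⟨h1, h2⟩ := hP.chapman t t ht ht x x
  simp only [hP.symm t ht _ x, ← sq] at h1 h2
  have hint := hP.integrable ht x
  set B := Metric.ball x (2 ^ n * √t) with hB
  have hBpos : 0 < μ.real B := hN.pos x (by positivity)
  set a : ℝ := 1 / (2 * μ.real B) with ha
  have key : ∫ u in B, (2 * a * P t x u - a ^ 2) ∂μ ≤ ∫ u in B, P t x u ^ 2 ∂μ := by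
    refine setIntegral_mono ((hint.const_mul _).sub (integrable_const _)).integrableOn
      h1.integrableOn fun u => ?_
    have := sq_nonneg (P t x u - a)
    simp only
    linarith
  rw [integral_sub (hint.const_mul _).integrableOn (integrable_const _).integrableOn,
    integral_const_mul, setIntegral_const, smul_eq_mul] at key
  have hle : ∫ u in B, P t x u ^ 2 ∂μ ≤ ∫ u, P t x u ^ 2 ∂μ :=
    setIntegral_le_integral h1 (ae_of_all _ fun u => sq_nonneg _)
  rw [h2]
  refine le_trans ?_ (key.trans hle)
  have hmass := hn t ht ht1 x
  have ha0 : 0 < a := by positivity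
  calc 1 / (4 * (2 ^ N) ^ n) / μ.real (Metric.ball x √t)
      = 1 / (4 * ((2 ^ N) ^ n * μ.real (Metric.ball x √t))) := by
        rw [div_div, mul_assoc]
    _ ≤ 1 / (4 * μ.real B) := by
        gcongr
        exact hN.measureReal_pow_mul_le x hst n
    _ = 2 * a * (1 / 2) - μ.real B * a ^ 2 := by
        rw [ha]
        field_simp
        norm_num
    _ ≤ _ := by gcongr

end KernelBounds

/-! ### Symmetry and compactness of the heat operators; isolated balls -/

section KernelOperators

variable {M : Type*} [MetricSpace M] [CompactSpace M] [Nonempty M] [MeasurableSpace M]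
  [BorelSpace M] {μ : Measure M} [IsFiniteMeasure μ] {N : ℕ}
  {S : ℝ → Lp ℝ 2 μ →L[ℝ] Lp ℝ 2 μ} {P : ℝ → M → M → ℝ}

theorem integrable_Lp_two (f : Lp ℝ 2 μ) : Integrable f μ :=
  (Lp.memLp f).integrable one_le_two

theorem inner_Lp_eq_integral (f g : Lp ℝ 2 μ) : ⟪f, g⟫_ℝ = ∫ x, f x * g x ∂μ := by
  rw [L2.inner_def]
  refine integral_congr_ae (ae_of_all _ fun x => ?_)
  simp [mul_comm]

theorem IsHeatKernel.norm_eq (hP : IsHeatKernel μ S P) {t : ℝ} (ht : 0 < t) (x y : M) :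
    ‖P t x y‖ = P t x y := Real.norm_of_nonneg (hP.nonneg t ht x y)

theorem IsHeatKernel.measurable_right (hP : IsHeatKernel μ S P) {t : ℝ} (ht : 0 < t) (x : M) :
    Measurable (P t x) := (hP.measurable t ht).of_uncurry_left

theorem IsHeatKernel.integrable_mul (hP : IsHeatKernel μ S P) (hN : DoublingExp μ N)
    (hG : GaussianBounds μ P) {t : ℝ} (ht : 0 < t) (x : M) {f : M → ℝ} (hf : Integrable f μ) :
    Integrable (fun y => P t x y * f y) μ := by
  obtain ⟨C, -, h⟩ := hP.exists_bound hN hG ht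
  exact hf.bdd_mul (c := C) (hP.measurable_right ht x).aestronglyMeasurable
    (ae_of_all _ fun y => by rw [hP.norm_eq ht]; exact h x y)

theorem IsHeatKernel.symmetric (hP : IsHeatKernel μ S P) (hN : DoublingExp μ N)
    (hG : GaussianBounds μ P) : ∀ t, 0 < t → ∀ u v, ⟪S t u, v⟫_ℝ = ⟪u, S t v⟫_ℝ := by
  intro t ht u v
  obtain ⟨C, -, h⟩ := hP.exists_bound hN hG ht
  have hint : Integrable (Function.uncurry fun x y => P t x y * (v x * u y)) (μ.prod μ) := by
    refine Integrable.bdd_mul (c := C) ((integrable_Lp_two v).mul_prod (integrable_Lp_two u))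
      (hP.measurable t ht).aestronglyMeasurable (ae_of_all _ fun z => ?_)
    show ‖P t z.1 z.2‖ ≤ C
    rw [hP.norm_eq ht]
    exact h _ _
  rw [inner_Lp_eq_integral, inner_Lp_eq_integral]
  calc ∫ x, S t u x * v x ∂μ = ∫ x, ∫ y, P t x y * (v x * u y) ∂μ ∂μ := by
        refine integral_congr_ae ?_
        filter_upwards [hP.apply_eq t ht u] with x hx
        rw [hx, ← integral_mul_const]
        refine integral_congr_ae (ae_of_all _ fun y => ?_)
        simp only
        ring
    _ = ∫ y, ∫ x, P t x y * (v x * u y) ∂μ ∂μ := integral_integral_swap hint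
    _ = ∫ y, u y * S t v y ∂μ := by
        refine integral_congr_ae ?_
        filter_upwards [hP.apply_eq t ht v] with y hy
        rw [hy, ← integral_const_mul]
        refine integral_congr_ae (ae_of_all _ fun x => ?_)
        simp only [hP.symm t ht x y]
        ring

theorem exists_simpleFunc_dist_lt {δ : ℝ} (hδ : 0 < δ) :
    ∃ φ : SimpleFunc M M, ∀ x, dist (φ x) x < δ := by
  obtain ⟨s, -, hs, hcov⟩ := finite_cover_balls_of_compact (isCompact_univ (X := M)) hδ
  have hne : s.Nonempty := by
    obtain ⟨x⟩ := ‹Nonempty M›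
    obtain ⟨y, hy, -⟩ := mem_iUnion₂.1 (hcov (mem_univ x))
    exact ⟨y, hy⟩
  obtain ⟨e, he⟩ := hs.countable.exists_eq_range hne
  have : ∀ y : s, ∃ k, e k = y := fun y => he.subset y.2
  choose k hk using this
  have := hs.to_subtype
  obtain ⟨n, hn⟩ := Finite.bddAbove_range k
  refine ⟨SimpleFunc.nearestPt e n, fun x => ?_⟩
  obtain ⟨y, hy, hxy⟩ := mem_iUnion₂.1 (hcov (mem_univ x))
  have h1 := SimpleFunc.edist_nearestPt_le e x (hn ⟨⟨y, hy⟩, rfl⟩)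
  rw [hk, edist_dist, edist_dist, ENNReal.ofReal_le_ofReal_iff dist_nonneg] at h1
  refine h1.trans_lt ?_
  rw [dist_comm]
  exact hxy

theorem isCompactOperator_smulRight {E F : Type*} [NormedAddCommGroup E] [NormedSpace ℝ E]
    [NormedAddCommGroup F] [NormedSpace ℝ F] (φ : E →L[ℝ] ℝ) (w : F) :
    IsCompactOperator (φ.smulRight w) := by
  have h : IsCompactOperator ((ContinuousLinearMap.toSpanSingleton ℝ w) ∘ id ∘ φ) :=
    (isCompactOperator_id.comp_clm φ).clm_comp (ContinuousLinearMap.toSpanSingleton ℝ w)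
  exact h

theorem exists_integral_abs_le : ∃ K : ℝ, 0 ≤ K ∧ ∀ f : Lp ℝ 2 μ, ∫ x, |f x| ∂μ ≤ K * ‖f‖ := by
  refine ⟨‖Lp.const 2 μ (1 : ℝ)‖, norm_nonneg _, fun f => ?_⟩
  have h1 := real_inner_le_norm (Lp.const 2 μ (1 : ℝ)) |f|
  rw [norm_abs_eq_norm] at h1
  refine le_trans (le_of_eq ?_) h1
  rw [inner_Lp_eq_integral]
  refine integral_congr_ae ?_
  filter_upwards [Lp.coeFn_const (p := 2) (μ := μ) (1 : ℝ), Lp.coeFn_abs f] with x h1 h2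
  rw [h1, h2]
  simp

/-- The heat kernel section `P t x` as an element of `L²`. -/
theorem IsHeatKernel.exists_section (hP : IsHeatKernel μ S P) (hN : DoublingExp μ N)
    (hG : GaussianBounds μ P) {t : ℝ} (ht : 0 < t) (x : M) : ∃ p : Lp ℝ 2 μ, p =ᵐ[μ] P t x := by
  obtain ⟨C, -, h⟩ := hP.exists_bound hN hG ht
  have : MemLp (P t x) 2 μ := MemLp.of_bound (hP.measurable_right ht x).aestronglyMeasurable C
    (ae_of_all _ fun y => by rw [hP.norm_eq ht]; exact h x y)
  exact ⟨this.toLp _, this.coeFn_toLp⟩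

theorem GaussianBounds.exists_modulus (hN : DoublingExp μ N) (hG : GaussianBounds μ P) {t : ℝ}
    (ht : 0 < t) (ht1 : t < 1) {η : ℝ} (hη : 0 < η) :
    ∃ δ : ℝ, 0 < δ ∧ ∀ x y y', dist y y' < δ → |P t x y - P t x y'| ≤ η := by
  obtain ⟨C, c, α, hC, hc, hα, h⟩ := hG
  obtain ⟨a, ha, hg⟩ := hN.exists_gaussianFactor_le hC hc
  have hst : 0 < √t := Real.sqrt_pos.2 ht
  set K := C / (a * √t ^ N) with hK
  have hK0 : 0 < K := by positivity
  refine ⟨min √t (√t * (η / K) ^ α⁻¹), by positivity, fun x y y' hyy => ?_⟩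
  have h1 := (h t ht ht1).2 x y y' (hyy.le.trans (min_le_left _ _))
  have h2 : gaussianFactor μ C c t x y ≤ K := by
    simpa using hg t ht ht1 0 x y le_rfl dist_nonneg
  have h3 : (dist y y' / √t) ^ α ≤ η / K := by
    have : dist y y' / √t ≤ (η / K) ^ α⁻¹ := by
      rw [div_le_iff₀' hst]
      exact hyy.le.trans (min_le_right _ _)
    calc (dist y y' / √t) ^ α ≤ ((η / K) ^ α⁻¹) ^ α :=
          Real.rpow_le_rpow (by positivity) this hα.le
      _ = η / K := by rw [← Real.rpow_mul (by positivity), inv_mul_cancel₀ hα.ne', Real.rpow_one]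
  calc |P t x y - P t x y'| ≤ (dist y y' / √t) ^ α * gaussianFactor μ C c t x y := h1
    _ ≤ (dist y y' / √t) ^ α * K := by gcongr
    _ ≤ η / K * K := by gcongr
    _ = η := div_mul_cancel₀ _ hK0.ne'

/-- `S t` is a norm limit of finite-rank operators: replace the kernel `P t x y` by `P t (φ x) y`,
where the simple function `φ` is uniformly close to the identity. The Hölder bound makes the error
in the kernel uniformly small. -/
theorem IsHeatKernel.isCompactOperator (hP : IsHeatKernel μ S P) (hN : DoublingExp μ N)
    (hG : GaussianBounds μ P) {t : ℝ} (ht : 0 < t) (ht1 : t < 1) : IsCompactOperator (S t) := by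
  have hcl := isClosed_setOfPred_isCompactOperator (σ₁₂ := RingHom.id ℝ) (M₁ := Lp ℝ 2 μ)
    (M₂ := Lp ℝ 2 μ)
  refine hcl.closure_subset (Metric.mem_closure_iff.2 fun ε hε => ?_)
  obtain ⟨K, hK0, hK⟩ := exists_integral_abs_le (μ := μ)
  set m : ℝ := (measureUnivNNReal μ : ℝ) ^ (2 : ℝ≥0∞).toReal⁻¹ with hm
  have hm0 : 0 ≤ m := by positivity
  -- A kernel bounded by `η` has operator norm at most `m * η * K`: `K` comes from the embedding of
  -- `L²` in `L¹`, `m` from that of `L^∞` in `L²`.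
  set η : ℝ := ε / (2 * (m * K + 1)) with hη
  have hη0 : 0 < η := by positivity
  obtain ⟨δ, hδ, hmod⟩ := hG.exists_modulus hN ht ht1 hη0
  obtain ⟨φ, hφ⟩ := exists_simpleFunc_dist_lt (M := M) hδ
  choose p hp using fun z => hP.exists_section hN hG ht z
  set T : Lp ℝ 2 μ →L[ℝ] Lp ℝ 2 μ := ∑ z ∈ φ.range, (innerSL ℝ (p z)).smulRight
    (indicatorConstLp 2 (φ.measurableSet_fiber z) (measure_ne_top _ _) (1 : ℝ)) with hT
  refine ⟨T, ?_, ?_⟩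
  · exact Submodule.sum_mem (compactOperator (RingHom.id ℝ) (Lp ℝ 2 μ) (Lp ℝ 2 μ))
      fun z _ => isCompactOperator_smulRight _ _
  · have happ : ∀ f : Lp ℝ 2 μ, ∀ᵐ x ∂μ, T f x = ∫ y, P t (φ x) y * f y ∂μ := by
      intro f
      have h1 : T f = ∑ z ∈ φ.range, ⟪p z, f⟫_ℝ •
          indicatorConstLp 2 (φ.measurableSet_fiber z) (measure_ne_top μ _) (1 : ℝ) := by
        simp [hT]
      have h2 : ∀ z, ⟪p z, f⟫_ℝ = ∫ y, P t z y * f y ∂μ := by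
        intro z
        rw [inner_Lp_eq_integral]
        refine integral_congr_ae ?_
        filter_upwards [hp z] with y hy
        rw [hy]
      have h3 : ∀ᵐ x ∂μ, ∀ z ∈ φ.range, (⟪p z, f⟫_ℝ •
          indicatorConstLp 2 (φ.measurableSet_fiber z) (measure_ne_top μ _) (1 : ℝ) : Lp ℝ 2 μ) x =
          ⟪p z, f⟫_ℝ * (φ ⁻¹' {z}).indicator (fun _ => (1 : ℝ)) x := by
        rw [Filter.eventually_all_finset]
        intro z _
        filter_upwards [Lp.coeFn_smul (⟪p z, f⟫_ℝ)
          (indicatorConstLp 2 (φ.measurableSet_fiber z) (measure_ne_top μ _) (1 : ℝ)),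
          indicatorConstLp_coeFn (p := 2) (hs := φ.measurableSet_fiber z)
          (hμs := measure_ne_top μ _) (c := (1 : ℝ))] with x hx1 hx2
        rw [hx1, Pi.smul_apply, hx2, smul_eq_mul]
      rw [h1]
      filter_upwards [Lp.coeFn_finsetSum φ.range fun z => ⟪p z, f⟫_ℝ •
        indicatorConstLp 2 (φ.measurableSet_fiber z) (measure_ne_top μ _) (1 : ℝ), h3] with x hx hx3
      rw [hx, Finset.sum_apply, Finset.sum_congr rfl hx3, Finset.sum_eq_single (φ x)]
      · simp [h2]
      · intro z _ hz
        simp [Ne.symm hz]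
      · intro h
        exact absurd (SimpleFunc.mem_range_self φ x) h
    rw [dist_eq_norm]
    have hle : ‖S t - T‖ ≤ m * (η * K) := by
      refine ContinuousLinearMap.opNorm_le_bound _ (by positivity) fun f => ?_
      have hb : ‖S t f - T f‖ ≤ m * (η * (K * ‖f‖)) := by
        refine Lp.norm_le_of_ae_bound (by positivity) ?_
        filter_upwards [Lp.coeFn_sub (S t f) (T f), hP.apply_eq t ht f, happ f] with x h1 h2 h3
        have hi := integrable_Lp_two f
        rw [h1, Pi.sub_apply, h2, h3, ← integral_sub (hP.integrable_mul hN hG ht x hi)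
          (hP.integrable_mul hN hG ht (φ x) hi)]
        calc ‖∫ y, (P t x y * f y - P t (φ x) y * f y) ∂μ‖
            ≤ ∫ y, ‖P t x y * f y - P t (φ x) y * f y‖ ∂μ := norm_integral_le_integral_norm _
          _ ≤ ∫ y, η * |f y| ∂μ := by
              refine integral_mono ?_ (hi.abs.const_mul η) fun y => ?_
              · exact ((hP.integrable_mul hN hG ht x hi).sub
                  (hP.integrable_mul hN hG ht (φ x) hi)).norm
              · simp only
                rw [← sub_mul, norm_mul, Real.norm_eq_abs, Real.norm_eq_abs, hP.symm t ht x y,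
                  hP.symm t ht (φ x) y]
                refine mul_le_mul_of_nonneg_right (hmod y x (φ x) ?_) (abs_nonneg _)
                rw [dist_comm]
                exact hφ x
          _ = η * ∫ y, |f y| ∂μ := integral_const_mul _ _
          _ ≤ η * (K * ‖f‖) := by gcongr; exact hK f
      calc ‖(S t - T) f‖ = ‖S t f - T f‖ := rfl
        _ ≤ m * (η * (K * ‖f‖)) := hb
        _ = _ := by ring
    refine hle.trans_lt ?_
    have : m * (η * K) = ε * ((m * K) / (2 * (m * K + 1))) := by rw [hη]; ring
    rw [this]
    refine mul_lt_of_lt_one_right hε ?_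
    rw [div_lt_one (by positivity)]
    have : 0 ≤ m * K := by positivity
    linarith

theorem IsHeatKernel.apply_const_one (hP : IsHeatKernel μ S P) {t : ℝ} (ht : 0 < t) :
    S t (Lp.const 2 μ (1 : ℝ)) = Lp.const 2 μ (1 : ℝ) := by
  refine Lp.ext ?_
  have h1 := Lp.coeFn_const (p := 2) (μ := μ) (1 : ℝ)
  filter_upwards [hP.apply_eq t ht (Lp.const 2 μ (1 : ℝ)), h1] with x hx hx1
  rw [hx, hx1, Function.const_apply]
  refine Eq.trans (integral_congr_ae ?_) (hP.mass t ht x)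
  filter_upwards [h1] with y hy
  rw [hy]
  simp

theorem IsHeatKernel.apply_indicator (hP : IsHeatKernel μ S P) {t : ℝ} (ht : 0 < t) {A : Set M}
    (hA : MeasurableSet A) :
    ∀ᵐ x ∂μ, S t (indicatorConstLp 2 hA (measure_ne_top μ A) (1 : ℝ)) x =
      ∫ y in A, P t x y ∂μ := by
  filter_upwards [hP.apply_eq t ht (indicatorConstLp 2 hA (measure_ne_top μ A) (1 : ℝ))]
    with x hx
  rw [hx, ← integral_indicator hA]
  refine integral_congr_ae ?_
  filter_upwards [indicatorConstLp_coeFn (p := 2) (hs := hA) (hμs := measure_ne_top μ A)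
    (c := (1 : ℝ))] with y hy
  rw [hy]
  by_cases h : y ∈ A <;> simp [h]

/-- A ball that is isolated from its complement has measure bounded below. -/
theorem IsHeatKernel.exists_isolated_ball_lower (hP : IsHeatKernel μ S P)
    (hN : DoublingExp μ N) (hG : GaussianBounds μ P) {ι : Type*}
    {b : HilbertBasis ι ℝ (Lp ℝ 2 μ)} {l : ι → ℝ}
    (hb : ∀ i t, 0 ≤ t → S t (b i) = Real.exp (-l i * t) • b i) (hl : ∀ i, 0 ≤ l i) :
    ∃ κ : ℝ, 0 < κ ∧ ∀ (x : M) (r : ℝ), 0 < r → (∀ y, r ≤ dist y x → 2 * r ≤ dist y x) →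
      κ ≤ μ.real (Metric.ball x r) := by
  have hsym := hP.symmetric hN hG
  obtain ⟨C, hC, hbound⟩ := hP.exists_bound hN hG one_pos
  refine ⟨C⁻¹, by positivity, fun x r hr hgap => ?_⟩
  set A := Metric.ball x r with hAdef
  have hA : MeasurableSet A := Metric.isOpen_ball.measurableSet
  have hsep : ∀ u ∈ A, ∀ y ∈ Aᶜ, r ≤ dist u y := by
    intro u hu y hy
    simp only [hAdef, mem_compl_iff, Metric.mem_ball, not_lt] at hu hy
    have h1 := hgap y hy
    have h2 := dist_triangle y u x
    rw [dist_comm y u] at h2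
    linarith
  obtain ⟨a, ha, hfar⟩ := exists_far_bound hN hG hr
  set f : Lp ℝ 2 μ := indicatorConstLp 2 hA (measure_ne_top μ A) (1 : ℝ) with hf
  -- On `A` the function `f - S t f` equals `∫ y in Aᶜ, P t u y`. The gap keeps `y` at distance at
  -- least `r` from `u`, so this is `O(t ^ 2)`.
  have hsmall : ∀ t, 0 < t → t < 1 → ⟪f - S t f, f⟫_ℝ ≤
      μ.real A * (a * t ^ 2 * μ.real (univ : Set M)) := by
    intro t ht ht1
    rw [real_inner_comm, hf, L2.inner_indicatorConstLp_one hA (measure_ne_top μ A), ← hf]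
    refine le_trans (le_abs_self _) ?_
    rw [← Real.norm_eq_abs, mul_comm (μ.real A)]
    refine norm_setIntegral_le_of_norm_le_const_ae' (measure_lt_top μ A) ?_
    filter_upwards [Lp.coeFn_sub f (S t f), hP.apply_indicator ht hA,
      indicatorConstLp_coeFn (p := 2) (hs := hA) (hμs := measure_ne_top μ A)
      (c := (1 : ℝ))] with u h1 h2 h3 hu
    have h4 := integral_add_compl (μ := μ) hA (hP.integrable ht u)
    rw [hP.mass t ht u] at h4
    rw [h1, Pi.sub_apply, hf, h2, h3, indicator_of_mem hu, ← h4, add_sub_cancel_left,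
      Real.norm_of_nonneg (setIntegral_nonneg hA.compl fun y _ => hP.nonneg t ht u y)]
    calc ∫ y in Aᶜ, P t u y ∂μ ≤ ∫ _ in Aᶜ, a * t ^ 2 ∂μ :=
          setIntegral_mono_on (hP.integrable ht u).integrableOn
            (integrable_const _).integrableOn hA.compl
            fun y hy => hfar t ht ht1 u y (hsep u hu y hy)
      _ = μ.real Aᶜ * (a * t ^ 2) := by rw [setIntegral_const, smul_eq_mul]
      _ ≤ μ.real univ * (a * t ^ 2) := by
          exact mul_le_mul_of_nonneg_right (measureReal_mono (subset_univ _)) (by positivity)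
      _ = _ := mul_comm _ _
  have hnn : ∀ t, 0 < t → 0 ≤ ⟪f - S t f, f⟫_ℝ := by
    intro t ht
    rw [inner_sub_left, real_inner_self_eq_norm_sq, sub_nonneg]
    calc ⟪S t f, f⟫_ℝ ≤ ‖S t f‖ * ‖f‖ := real_inner_le_norm _ _
      _ ≤ ‖f‖ * ‖f‖ := by gcongr; exact norm_semigroup_le hsym hb hl ht f
      _ = ‖f‖ ^ 2 := (sq _).symm
  have hlim : Tendsto (fun t => t⁻¹ * ⟪f - S t f, f⟫_ℝ) (𝓝[>] 0) (𝓝 0) := by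
    have hup : Tendsto (fun t : ℝ => t * (μ.real A * (a * μ.real (univ : Set M)))) (𝓝[>] 0)
        (𝓝 0) := by
      have : Tendsto (fun t : ℝ => t * (μ.real A * (a * μ.real (univ : Set M)))) (𝓝 0)
          (𝓝 (0 * (μ.real A * (a * μ.real (univ : Set M))))) := tendsto_id.mul_const _
      rw [zero_mul] at this
      exact this.mono_left nhdsWithin_le_nhds
    refine tendsto_of_tendsto_of_tendsto_of_le_of_le' tendsto_const_nhds hup ?_ ?_
    · filter_upwards [self_mem_nhdsWithin] with t ht
      exact mul_nonneg (inv_nonneg.2 (le_of_lt ht)) (hnn t ht)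
    · filter_upwards [Ioo_mem_nhdsGT one_pos] with t ht
      rw [inv_mul_le_iff₀ ht.1]
      refine (hsmall t ht.1 ht.2).trans (le_of_eq ?_)
      ring
  have hinv : S 1 f = f := semigroup_eq_self hsym hb hl hlim one_pos
  -- Invariance at time `1` reads `1 = ∫ y in A, P 1 u y` for almost every `u ∈ A`; such `u` exist
  -- because `A` has positive measure.
  have hae : ∀ᵐ u ∂μ, u ∈ A → 1 ≤ C * μ.real A := by
    filter_upwards [hP.apply_indicator one_pos hA,
      indicatorConstLp_coeFn (p := 2) (hs := hA) (hμs := measure_ne_top μ A)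
      (c := (1 : ℝ))] with u h2 h3 hu
    rw [← hf, hinv, hf, h3, indicator_of_mem hu] at h2
    rw [h2]
    calc ∫ y in A, P 1 u y ∂μ ≤ ∫ _ in A, C ∂μ :=
          integral_mono (hP.integrable one_pos u).integrableOn (integrable_const _)
            fun y => hbound u y
      _ = C * μ.real A := by rw [setIntegral_const, smul_eq_mul, mul_comm]
  rw [inv_le_iff_one_le_mul₀' hC]
  by_contra hcon
  have hz : μ A = 0 := by
    have : ∀ᵐ u ∂μ, u ∉ A := hae.mono fun u hu hmem => hcon (hu hmem)
    exact measure_eq_zero_iff_ae_notMem.2 this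
  have := hN.pos x hr
  rw [← hAdef, measureReal_def, hz] at this
  simp at this

end KernelOperators

/-! ### Absence of large spectral gaps -/

section SpectralWindow

/-- If no eigenvalue lies strictly between `Λ` and `Λ'`, then the norm of a semigroup orbit is
controlled by its value at a later time and a small multiple of its value at an earlier time. -/
theorem norm_sq_orbit_le {E : Type*} [NormedAddCommGroup E] [InnerProductSpace ℝ E]
    {S : ℝ → E →L[ℝ] E} {ι : Type*} {b : HilbertBasis ι ℝ E} {l : ι → ℝ}
    (hsym : ∀ t, 0 < t → ∀ u v, ⟪S t u, v⟫_ℝ = ⟪u, S t v⟫_ℝ)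
    (hb : ∀ i t, 0 ≤ t → S t (b i) = Real.exp (-l i * t) • b i) {p : ℝ → E}
    (hp : ∀ u t, 0 < u → 0 < t → S u (p t) = p (u + t)) {Λ Λ' τ u : ℝ} (hτ : 0 < τ) (hu : 0 < u)
    (hgap : ∀ i, l i ≤ Λ ∨ Λ' ≤ l i) :
    ‖p τ‖ ^ 2 ≤ Real.exp (2 * Λ * u) * ‖p (u + τ)‖ ^ 2 + Real.exp (-(Λ' * τ)) * ‖p (τ / 2)‖ ^ 2 := by
  refine hasSum_le (fun i => ?_) (hasSum_inner_sq b (p τ))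
    (((hasSum_inner_sq b (p (u + τ))).mul_left _).add
      ((hasSum_inner_sq b (p (τ / 2))).mul_left _))
  have hτ2 : 0 < τ / 2 := by positivity
  have h1 : ⟪b i, p (u + τ)⟫_ℝ = Real.exp (-l i * u) * ⟪b i, p τ⟫_ℝ := by
    rw [← hp u τ hu hτ, inner_basis_semigroup hsym hb hu]
  have h2 : ⟪b i, p τ⟫_ℝ = Real.exp (-l i * (τ / 2)) * ⟪b i, p (τ / 2)⟫_ℝ := by
    rw [← inner_basis_semigroup hsym hb hτ2, hp _ _ hτ2 hτ2, add_halves]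
  -- A low mode loses at most the factor `exp (-2 Λ u)` in its square from time `τ` to `u + τ`; a
  -- high mode has already lost `exp (-Λ' τ)` between `τ / 2` and `τ`.
  rcases hgap i with h | h
  · refine le_add_of_le_of_nonneg ?_ (by positivity)
    rw [h1, mul_pow, ← mul_assoc, ← Real.exp_nat_mul, ← Real.exp_add]
    refine le_mul_of_one_le_left (sq_nonneg _) (Real.one_le_exp ?_)
    push_cast
    nlinarith
  · refine le_add_of_nonneg_of_le (by positivity) ?_
    rw [h2, mul_pow, ← Real.exp_nat_mul]
    refine mul_le_mul_of_nonneg_right (Real.exp_le_exp.2 ?_) (sq_nonneg _)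
    push_cast
    nlinarith

variable {M : Type*} [MetricSpace M] [CompactSpace M] [MeasurableSpace M]
  [BorelSpace M] {μ : Measure M} [IsFiniteMeasure μ] {N : ℕ}
  {S : ℝ → Lp ℝ 2 μ →L[ℝ] Lp ℝ 2 μ} {P : ℝ → M → M → ℝ}

/-- The heat kernel sections at a point form an orbit of the semigroup in `L²`. -/
theorem IsHeatKernel.exists_orbit [Nonempty M] (hP : IsHeatKernel μ S P) (hN : DoublingExp μ N)
    (hG : GaussianBounds μ P) (x : M) : ∃ p : ℝ → Lp ℝ 2 μ,
      (∀ u t, 0 < u → 0 < t → S u (p t) = p (u + t)) ∧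
      ∀ t, 0 < t → ‖p t‖ ^ 2 = P (t + t) x x := by
  choose q hq using fun t (ht : 0 < t) => hP.exists_section hN hG ht x
  let p : ℝ → Lp ℝ 2 μ := fun t => if ht : 0 < t then q t ht else 0
  have hp : ∀ t, 0 < t → p t =ᵐ[μ] P t x := by
    intro t ht
    simp only [p, dif_pos ht]
    exact hq t ht
  refine ⟨p, fun u t hu ht => Lp.ext ?_, fun t ht => ?_⟩
  · filter_upwards [hP.apply_eq u hu (p t), hp (u + t) (add_pos hu ht)] with z h1 h2
    rw [h1, h2, hP.symm _ (add_pos hu ht) x z, (hP.chapman u t hu ht z x).2]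
    refine integral_congr_ae ?_
    filter_upwards [hp t ht] with y hy
    rw [hy, hP.symm t ht x y]
  · rw [← real_inner_self_eq_norm_sq, inner_Lp_eq_integral, (hP.chapman t t ht ht x x).2]
    refine integral_congr_ae ?_
    filter_upwards [hp t ht] with y hy
    rw [hy, hP.symm t ht y x]

/-- The spectrum has no large multiplicative gaps. -/
theorem IsHeatKernel.exists_window [Infinite M] (hP : IsHeatKernel μ S P) (hN : DoublingExp μ N)
    (hG : GaussianBounds μ P) {ι : Type*} {b : HilbertBasis ι ℝ (Lp ℝ 2 μ)} {l : ι → ℝ}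
    (hb : ∀ i t, 0 ≤ t → S t (b i) = Real.exp (-l i * t) • b i) (hl : ∀ i, 0 ≤ l i) :
    ∃ β Λ₀ : ℝ, 1 ≤ Λ₀ ∧ ∀ Λ, Λ₀ ≤ Λ → ∃ i, Λ < l i ∧ l i < β * Λ := by
  have hsym := hP.symmetric hN hG
  obtain ⟨x, hx⟩ := hN.exists_tendsto_zero
  obtain ⟨κ, hκ, hiso⟩ := hP.exists_isolated_ball_lower hN hG hb hl
  obtain ⟨r₀, hr₀, hr₀'⟩ := mem_nhdsGT_iff_exists_Ioc_subset.1 (hx.eventually (gt_mem_nhds hκ))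
  have hr₀pos : (0 : ℝ) < r₀ := hr₀
  -- Balls at `x` of radius at most `r₀` weigh less than `κ`, so none of those smaller than `r₀` can
  -- be isolated.
  have hann : ∀ r, 0 < r → r < r₀ → ∃ y, r ≤ dist y x ∧ dist y x < 2 * r := by
    intro r hr hrr
    by_contra! hcon
    exact absurd (hiso x r hr hcon) (not_le.2 (hr₀' ⟨hr, hrr.le⟩))
  obtain ⟨C, hC, hup⟩ := exists_diag_upper hG
  obtain ⟨c, hc, hlow⟩ := hP.exists_diag_lower hN hG
  -- `k` makes the volume ratio exceed what the low modes allow, the `max` with `1` forcing `k ≠ 0`;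
  -- `a` below makes the high modes at most half of the diagonal lower bound.
  obtain ⟨k, hk⟩ := hN.exists_reverse hann (max 1 (2 * Real.exp 1 * C / c))
  obtain ⟨a, ha⟩ := exists_gt (max 0 (Real.log (2 * C / c)))
  have ha0 : 0 < a := (le_max_left _ _).trans_lt ha
  have hexpa : Real.exp (-a) * C ≤ c / 2 := by
    have h1 : 2 * C / c ≤ Real.exp a := by
      rw [← Real.log_le_iff_le_exp (by positivity)]
      exact ((le_max_right _ _).trans_lt ha).le
    rw [div_le_iff₀ hc] at h1
    rw [Real.exp_neg, inv_mul_le_iff₀ (Real.exp_pos _)]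
    linarith
  refine ⟨a * 64 ^ k, max 2 (2 / r₀ ^ 2), le_trans (by norm_num) (le_max_left _ _),
    fun Λ hΛ => ?_⟩
  have hΛ2 : 2 ≤ Λ := (le_max_left _ _).trans hΛ
  have hΛr : 2 / r₀ ^ 2 ≤ Λ := (le_max_right _ _).trans hΛ
  have hΛ0 : 0 < Λ := by linarith
  by_contra! hcon
  -- The two time scales: `T = 1 / Λ` keeps `exp (2 Λ u) ≤ e`, and `τ = T / 64 ^ k` corresponds to
  -- radii with ratio `8 ^ k`. Below, `u + τ = T / 2`, so that the later orbit norm is exactly `P T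
  -- x x`.
  set T : ℝ := 1 / Λ with hT
  have hT0 : 0 < T := by positivity
  have hT1 : T < 1 := by
    rw [hT, div_lt_one hΛ0]
    linarith
  set τ : ℝ := T / 64 ^ k with hτ
  have hτ0 : 0 < τ := by positivity
  have hsq : √T = 8 ^ k * √τ := by
    rw [show T = (8 ^ k) ^ 2 * τ by
      rw [hτ, ← pow_mul, mul_comm k, pow_mul]
      norm_num
      field_simp, Real.sqrt_mul (by positivity), Real.sqrt_sq (by positivity)]
  have hTr : √T < r₀ := by
    rw [Real.sqrt_lt' hr₀pos, hT, div_lt_iff₀ hΛ0]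
    rw [div_le_iff₀ (by positivity)] at hΛr
    linarith
  have hsτ : 0 < √τ := Real.sqrt_pos.2 hτ0
  have hrev := hk √τ hsτ (by rw [← hsq]; exact hTr)
  rw [← hsq] at hrev
  have hB := hN.pos x hsτ
  have hB' := hN.pos x (Real.sqrt_pos.2 hT0)
  have hk1 : k ≠ 0 := by
    rintro rfl
    simp only [pow_zero, one_mul] at hsq
    rw [hsq] at hrev
    have := le_max_left 1 (2 * Real.exp 1 * C / c)
    nlinarith
  have h64 : (64 : ℝ) ≤ 64 ^ k := le_self_pow₀ (by norm_num) hk1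
  have hτT : 64 * τ ≤ T := by
    rw [hτ, mul_div_assoc', div_le_iff₀ (by positivity)]
    nlinarith
  obtain ⟨p, hp1, hp2⟩ := hP.exists_orbit hN hG x
  set u : ℝ := T / 2 - τ with hu
  have hu0 : 0 < u := by
    rw [hu]
    linarith
  have horb := norm_sq_orbit_le hsym hb hp1 (Λ := Λ) (Λ' := a * 64 ^ k * Λ) hτ0 hu0
    (fun i => (le_or_gt (l i) Λ).imp_right (hcon i))
  have e1 : a * 64 ^ k * Λ * τ = a := by
    rw [hτ, hT]
    field_simp
  have e2 : u + τ + (u + τ) = T := by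
    rw [hu]
    ring
  have e3 : 2 * Λ * u ≤ 1 := by
    have : Λ * T = 1 := by
      rw [hT]
      field_simp
    rw [hu]
    nlinarith
  rw [e1, hp2 _ hτ0, hp2 _ (add_pos hu0 hτ0), hp2 _ (half_pos hτ0), e2, add_halves] at horb
  have l1 := hlow τ hτ0 (by linarith) x
  have l2 := hup τ hτ0 (by linarith) x
  have l3 := hup T hT0 hT1 x
  -- Absorbing the last term bounds `|B(x, √T)|` by `(2 e C / c) |B(x, √τ)|`, against reverse
  -- doubling.
  have hmain : c / μ.real (Metric.ball x √τ) ≤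
      Real.exp 1 * (C / μ.real (Metric.ball x √T)) + c / 2 / μ.real (Metric.ball x √τ) := by
    refine l1.trans (horb.trans (add_le_add ?_ ?_))
    · have := hP.nonneg T hT0 x x
      gcongr
    · calc Real.exp (-a) * P τ x x ≤ Real.exp (-a) * (C / μ.real (Metric.ball x √τ)) := by gcongr
        _ = Real.exp (-a) * C / μ.real (Metric.ball x √τ) := by ring
        _ ≤ _ := by gcongr
  have h4 : c / 2 / μ.real (Metric.ball x √τ) ≤ Real.exp 1 * C / μ.real (Metric.ball x √T) := by
    have : c / μ.real (Metric.ball x √τ) = c / 2 / μ.real (Metric.ball x √τ) +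
        c / 2 / μ.real (Metric.ball x √τ) := by ring
    rw [mul_div_assoc]
    linarith
  rw [div_le_div_iff₀ hB hB'] at h4
  have h5 : 2 * Real.exp 1 * C / c * μ.real (Metric.ball x √τ) < μ.real (Metric.ball x √T) :=
    lt_of_le_of_lt (mul_le_mul_of_nonneg_right (le_max_right _ _) hB.le) hrev
  rw [div_mul_eq_mul_div, div_lt_iff₀ hc] at h5
  linarith

end SpectralWindow

/-! ### The reproducing kernel Hilbert space of the heat kernel -/

section ReproducingKernel

variable {M : Type*} [MetricSpace M] [CompactSpace M] [Nonempty M] [MeasurableSpace M]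
  [BorelSpace M] {μ : Measure M} [IsFiniteMeasure μ] {N : ℕ}
  {S : ℝ → Lp ℝ 2 μ →L[ℝ] Lp ℝ 2 μ} {P : ℝ → M → M → ℝ}

theorem kernel_ofKernel_apply {X : Type*} {K : X → X → ℝ} [Fact (kernelMatrix K).PosSemidef]
    (x y : X) (v : ℝ) :
    RKHS.kernel (RKHS.OfKernel (kernelMatrix K)) x y v = K x y * v := by
  rw [RKHS.OfKernel.kernel_ofKernel]
  simp [kernelMatrix]

/-- Kernel sections are measurable and span a dense subspace, and norm convergence implies pointwise
convergence. -/
theorem IsHeatKernel.rkhs_measurable (hP : IsHeatKernel μ S P) {t : ℝ} (ht : 0 < t)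
    [Fact (kernelMatrix (P t)).PosSemidef] (h : RKHS.OfKernel (kernelMatrix (P t))) :
    Measurable (h : M → ℝ) := by
  have hd := RKHS.kerFun_dense (RKHS.OfKernel (kernelMatrix (P t)))
  have hmem : h ∈ closure (Submodule.span ℝ
      {RKHS.kerFun (RKHS.OfKernel (kernelMatrix (P t))) x v | (x) (v)} : Set _) := by
    rw [← Submodule.topologicalClosure_coe, hd]
    trivial
  obtain ⟨g, hg, hlim⟩ := mem_closure_iff_seq_limit.1 hmem
  refine measurable_of_tendsto_metrizable (f := fun n => (g n : M → ℝ)) (fun n => ?_)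
    (tendsto_pi_nhds.2 fun x => ((RKHS.continuous_eval x).tendsto h).comp hlim)
  refine Submodule.span_induction
    (p := fun (f : RKHS.OfKernel (kernelMatrix (P t))) _ => Measurable (f : M → ℝ))
    ?_ ?_ ?_ ?_ (hg n)
  · rintro _ ⟨x, v, rfl⟩
    have : (RKHS.kerFun (RKHS.OfKernel (kernelMatrix (P t))) x v : M → ℝ) =
        fun y => P t x y * v := by
      funext y
      rw [RKHS.kerFun_apply, kernel_ofKernel_apply, hP.symm t ht]
    rw [this]
    exact (hP.measurable_right ht x).mul_const v
  · rw [RKHS.coe_zero]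
    exact measurable_const
  · intro f g _ _ hf hg
    rw [RKHS.coe_add]
    exact hf.add hg
  · intro c f _ hf
    rw [RKHS.coe_smul]
    exact hf.const_smul c

theorem IsHeatKernel.rkhs_exists_bound (hP : IsHeatKernel μ S P) (hN : DoublingExp μ N)
    (hG : GaussianBounds μ P) {t : ℝ} (ht : 0 < t) [Fact (kernelMatrix (P t)).PosSemidef] :
    ∃ K : ℝ, 0 ≤ K ∧ ∀ (h : RKHS.OfKernel (kernelMatrix (P t))) (x : M), |h x| ≤ K * ‖h‖ := by
  obtain ⟨C, hC, hbound⟩ := hP.exists_bound hN hG ht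
  refine ⟨√C, Real.sqrt_nonneg _, fun h x => ?_⟩
  have h1 := RKHS.norm_apply_le h x
  have h2 : ‖RKHS.kernel (RKHS.OfKernel (kernelMatrix (P t))) x x‖ ≤ C := by
    refine ContinuousLinearMap.opNorm_le_bound _ hC.le fun v => ?_
    rw [kernel_ofKernel_apply, norm_mul, hP.norm_eq ht]
    exact mul_le_mul_of_nonneg_right (hbound x x) (norm_nonneg _)
  rw [← Real.norm_eq_abs, mul_comm]
  exact h1.trans (mul_le_mul_of_nonneg_left (Real.sqrt_le_sqrt h2) (norm_nonneg _))

/-- The pairing of an element of the reproducing kernel Hilbert space of the heat kernel at time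
`t` with `v` is controlled by the norm of `S (t / 2) v`. -/
theorem IsHeatKernel.rkhs_pairing_le (hP : IsHeatKernel μ S P) (hN : DoublingExp μ N)
    (hG : GaussianBounds μ P) {t : ℝ} (ht : 0 < t) [Fact (kernelMatrix (P t)).PosSemidef]
    (h : RKHS.OfKernel (kernelMatrix (P t))) (v : Lp ℝ 2 μ) :
    |∫ x, v x * h x ∂μ| ≤ ‖S (t / 2) v‖ * ‖h‖ := by
  have ht2 : 0 < t / 2 := by positivity
  have hsym := hP.symmetric hN hG
  obtain ⟨K, hK, hbd⟩ := hP.rkhs_exists_bound hN hG ht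
  have hint : ∀ f : RKHS.OfKernel (kernelMatrix (P t)), Integrable (fun x => v x * f x) μ :=
    fun f => (integrable_Lp_two v).mul_bdd (c := K * ‖f‖)
      (hP.rkhs_measurable ht f).aestronglyMeasurable (ae_of_all _ fun x => hbd f x)
  let ψ : RKHS.OfKernel (kernelMatrix (P t)) →ₗ[ℝ] ℝ :=
    { toFun := fun f => ∫ x, v x * f x ∂μ
      map_add' := fun f g => by
        rw [← integral_add (hint f) (hint g)]
        simp [mul_add]
      map_smul' := fun c f => by
        rw [RingHom.id_apply, smul_eq_mul, ← integral_const_mul]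
        refine integral_congr_ae (ae_of_all _ fun x => ?_)
        simp
        ring }
  have hψ : Continuous ψ := by
    refine AddMonoidHomClass.continuous_of_bound ψ (K * ∫ x, |v x| ∂μ) fun f => ?_
    calc ‖∫ x, v x * f x ∂μ‖ ≤ ∫ x, ‖v x * f x‖ ∂μ := norm_integral_le_integral_norm _
      _ ≤ ∫ x, |v x| * (K * ‖f‖) ∂μ := by
          refine integral_mono (hint f).norm ((integrable_Lp_two v).abs.mul_const _) fun x => ?_
          simp only [norm_mul, Real.norm_eq_abs]
          exact mul_le_mul_of_nonneg_left (hbd f x) (abs_nonneg _)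
      _ = _ := by rw [integral_mul_const]; ring
  choose p hp using fun z => hP.exists_section hN hG ht2 z
  have hpp : ∀ x y, ⟪p x, p y⟫_ℝ = P t x y := by
    intro x y
    have h1 := (hP.chapman (t / 2) (t / 2) ht2 ht2 x y).2
    rw [add_halves] at h1
    rw [h1, inner_Lp_eq_integral]
    refine integral_congr_ae ?_
    filter_upwards [hp x, hp y] with u hx hy
    rw [hx, hy, hP.symm _ ht2 y u]
  -- The graph of the isometry sending the kernel section at `x` to `P (t / 2) x ∈ L²`. Spanning in
  -- the product avoids proving that the map is well defined. For a pair `q` in `R`, `q.1 = S (t /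
  -- 2) q.2` almost everywhere.
  let R : Submodule ℝ (RKHS.OfKernel (kernelMatrix (P t)) × Lp ℝ 2 μ) :=
    Submodule.span ℝ {q | ∃ (x : M) (c : ℝ), q = (RKHS.kerFun _ x c, c • p x)}
  have hR1 : ∀ q ∈ R, ∀ (x : M) (c : ℝ),
      ⟪q.1, RKHS.kerFun (RKHS.OfKernel (kernelMatrix (P t))) x c⟫_ℝ = ⟪q.2, c • p x⟫_ℝ := by
    intro q hq x c
    induction hq using Submodule.span_induction with
    | mem q hq =>
      obtain ⟨y, d, rfl⟩ := hq
      rw [← RKHS.kernel_inner, kernel_ofKernel_apply, inner_smul_left,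
        inner_smul_right, hpp, hP.symm t ht x y]
      simp
      ring
    | zero => simp
    | add a b _ _ ha hb => rw [Prod.fst_add, Prod.snd_add, inner_add_left, inner_add_left, ha, hb]
    | smul r a _ ha => rw [Prod.smul_fst, Prod.smul_snd, inner_smul_left, inner_smul_left, ha]
  have hR2 : ∀ q ∈ R, ∀ q' ∈ R, ⟪q.1, q'.1⟫_ℝ = ⟪q.2, q'.2⟫_ℝ := by
    intro q hq q' hq'
    induction hq' using Submodule.span_induction with
    | mem q' hq' =>
      obtain ⟨y, d, rfl⟩ := hq'
      exact hR1 q hq y d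
    | zero => simp
    | add a b _ _ ha hb =>
      rw [Prod.fst_add, Prod.snd_add, inner_add_right, inner_add_right, ha, hb]
    | smul r a _ ha => rw [Prod.smul_fst, Prod.smul_snd, inner_smul_right, inner_smul_right, ha]
  have hR3 : ∀ q ∈ R, |ψ q.1| ≤ ‖S (t / 2) v‖ * ‖q.1‖ := by
    intro q hq
    have hn : ‖q.1‖ = ‖q.2‖ := by
      have := hR2 q hq q hq
      rw [real_inner_self_eq_norm_sq, real_inner_self_eq_norm_sq] at this
      exact (sq_eq_sq₀ (norm_nonneg _) (norm_nonneg _)).1 this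
    have hval : ∀ᵐ x ∂μ, q.1 x = S (t / 2) q.2 x := by
      filter_upwards [hP.apply_eq _ ht2 q.2] with x hx
      have h1 := hR1 q hq x 1
      rw [RKHS.inner_kerFun, one_smul, inner_Lp_eq_integral] at h1
      rw [hx]
      refine Eq.trans (by simpa using h1) (integral_congr_ae ?_)
      filter_upwards [hp x] with u hu
      rw [hu, mul_comm]
    have hψq : ψ q.1 = ⟪S (t / 2) v, q.2⟫_ℝ := by
      rw [hsym _ ht2, inner_Lp_eq_integral]
      refine integral_congr_ae ?_
      filter_upwards [hval] with x hx
      rw [hx]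
    rw [hψq, hn]
    exact abs_real_inner_le_norm _ _
  have hd := RKHS.kerFun_dense (RKHS.OfKernel (kernelMatrix (P t)))
  have hmem : h ∈ closure (Submodule.span ℝ
      {RKHS.kerFun (RKHS.OfKernel (kernelMatrix (P t))) x v | (x) (v)} : Set _) := by
    rw [← Submodule.topologicalClosure_coe, hd]
    trivial
  have hcl : IsClosed {f | |ψ f| ≤ ‖S (t / 2) v‖ * ‖f‖} :=
    isClosed_le (by fun_prop) (by fun_prop)
  refine closure_minimal (fun f hf => ?_) hcl hmem
  have hproj : Submodule.span ℝ {RKHS.kerFun (RKHS.OfKernel (kernelMatrix (P t))) x v | (x) (v)} ≤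
      R.map (LinearMap.fst ℝ _ _) := by
    refine Submodule.span_le.2 ?_
    rintro _ ⟨x, c, rfl⟩
    exact ⟨_, Submodule.subset_span ⟨x, c, rfl⟩, rfl⟩
  obtain ⟨q, hq, rfl⟩ := hproj hf
  exact hR3 q hq

end ReproducingKernel

/-! ### A lacunary series in the unit ball of the Besov space -/

section LacunarySeries

variable {E : Type*} [NormedAddCommGroup E] [InnerProductSpace ℝ E] [CompleteSpace E]

theorem Orthonormal.exists_hasSum {ι : Type*} {e : ι → E} (he : Orthonormal ℝ e) {c : ι → ℝ}
    (hc : Summable fun n => c n ^ 2) : ∃ f, HasSum (fun n => c n • e n) f := by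
  have := (he.orthogonalFamily.summable_iff_norm_sq_summable c).2 (by simpa using hc)
  exact ⟨_, by simpa using this.hasSum⟩

theorem Orthonormal.inner_hasSum {ι : Type*} {e : ι → E} (he : Orthonormal ℝ e) {c : ι → ℝ}
    {f : E} (hf : HasSum (fun n => c n • e n) f) (n : ι) : ⟪e n, f⟫_ℝ = c n := by
  have h1 := hf.mapL (innerSL ℝ (e n))
  have h2 : HasSum (fun k => innerSL ℝ (e n) (c k • e k)) (innerSL ℝ (e n) (c n • e n)) :=
    hasSum_single n fun k hk => by
      simp [he.2 (Ne.symm hk)]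
  have h3 := h1.unique h2
  simpa [inner_smul_right, he.1 n] using h3

theorem Orthonormal.hasSum_norm_sq {ι : Type*} {e : ι → E} (he : Orthonormal ℝ e) {c : ι → ℝ}
    {f : E} (hf : HasSum (fun n => c n • e n) f) : HasSum (fun n => c n ^ 2) (‖f‖ ^ 2) := by
  have h1 := hf.mapL (innerSL ℝ f)
  rw [innerSL_apply_apply, real_inner_self_eq_norm_sq] at h1
  refine h1.congr_fun fun n => ?_
  rw [innerSL_apply_apply, inner_smul_right, real_inner_comm, Orthonormal.inner_hasSum he hf, sq]

/-- The functional calculus on an orthogonal series of eigenvectors with distinct eigenvalues. -/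
theorem hasSum_sqrtCalculus {L : E →ₗ.[ℝ] E} {ι : Type*}
    (horth : ∀ l m : ℝ, l ≠ m → ∀ u v, (u, l • u) ∈ L.graph → (v, m • v) ∈ L.graph →
      ⟪u, v⟫_ℝ = 0) {e : ι → E} {m : ι → ℝ} (hm : Function.Injective m)
    (he : ∀ n, (e n, m n • e n) ∈ L.graph) {c : ι → ℝ} {f g : E}
    (hf : HasSum (fun n => c n • e n) f) {F : ℝ → ℝ}
    (hg : HasSum (fun n => (F √(m n) * c n) • e n) g) : sqrtCalculus L F f = g := by
  have hself : ∀ n, (eigenspace L (m n)).topologicalClosure.starProjection (e n) = e n := by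
    intro n
    rw [Submodule.starProjection_eq_self_iff]
    exact Submodule.le_topologicalClosure _ (he n)
  have hzero : ∀ l n, l ≠ m n → (eigenspace L l).topologicalClosure.starProjection (e n) = 0 := by
    intro l n hl
    refine (Submodule.eq_starProjection_of_mem_of_inner_eq_zero (Submodule.zero_mem _) ?_)
    intro w hw
    rw [sub_zero]
    have hcl : IsClosed {w : E | ⟪e n, w⟫_ℝ = 0} := isClosed_eq (by fun_prop) continuous_const
    refine closure_minimal (fun u hu => ?_) hcl hw
    exact horth (m n) l (Ne.symm hl) _ _ (he n) hu
  have hproj : ∀ l, HasSum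
      (fun n => c n • (eigenspace L l).topologicalClosure.starProjection (e n))
      ((eigenspace L l).topologicalClosure.starProjection f) := by
    intro l
    have := hf.mapL (eigenspace L l).topologicalClosure.starProjection
    simpa only [map_smul] using this
  have hval : ∀ n, (eigenspace L (m n)).topologicalClosure.starProjection f = c n • e n := by
    intro n
    refine (hproj (m n)).unique ?_
    have := hasSum_single (f := fun k =>
      c k • (eigenspace L (m n)).topologicalClosure.starProjection (e k)) n fun k hk => by
        rw [hzero _ _ fun h => hk (hm h).symm, smul_zero]
    rwa [hself] at this
  have hout : ∀ l, l ∉ range m → (eigenspace L l).topologicalClosure.starProjection f = 0 := by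
    intro l hl
    refine (hproj l).unique ?_
    have : (fun n => c n • (eigenspace L l).topologicalClosure.starProjection (e n)) =
        fun _ => 0 := by
      funext n
      rw [hzero l n fun h => hl ⟨n, h.symm⟩, smul_zero]
    rw [this]
    exact hasSum_zero
  -- Only the `l` in the range of `m` contribute to the sum over all reals, and injectivity of `m`
  -- reindexes them by `ι`.
  refine HasSum.tsum_eq ((hm.hasSum_iff fun l hl => ?_).1 ?_)
  · rw [hout l hl, smul_zero]
  · refine hg.congr_fun fun n => ?_
    simp only [Function.comp_apply]
    rw [hval, smul_smul]

/-- On `[0, 1]` the continuous function `Φ` takes only the values `±1`, and `Φ 1 ≥ 0` selects the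
sign. -/
theorem IsLittlewoodPaley.eq_one {Φ : ℝ → ℝ} (hΦ : IsLittlewoodPaley Φ) {x : ℝ} (hx : 0 ≤ x)
    (hx1 : x ≤ 1) : Φ x = 1 := by
  have hcont : ContinuousOn Φ (Icc x 1) :=
    hΦ.smooth.continuousOn.mono fun y hy => hx.trans hy.1
  have h1 : Φ 1 = 1 := by
    have := hΦ.abs_eq_one 1 zero_le_one le_rfl
    rwa [abs_of_nonneg (hΦ.nonneg 1 le_rfl)] at this
  by_contra hne
  have hneg : Φ x = -1 := (eq_or_eq_neg_of_abs_eq (hΦ.abs_eq_one x hx hx1)).resolve_left hne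
  obtain ⟨y, hy, hy0⟩ := intermediate_value_Icc hx1 hcont
    (show (0 : ℝ) ∈ Icc (Φ x) (Φ 1) by rw [hneg, h1]; norm_num)
  have := hΦ.abs_eq_one y (hx.trans hy.1) hy.2
  rw [hy0] at this
  norm_num at this

theorem IsLittlewoodPaley.exists_bound {Φ : ℝ → ℝ} (hΦ : IsLittlewoodPaley Φ) :
    ∃ K : ℝ, 0 ≤ K ∧ ∀ x, 0 ≤ x → |Φ x| ≤ K := by
  obtain ⟨K, hK⟩ := isCompact_Icc.exists_bound_of_continuousOn
    (hΦ.smooth.continuousOn.mono fun y (hy : y ∈ Icc (0 : ℝ) 2) => hy.1)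
  refine ⟨max K 0, le_max_right _ _, fun x hx => ?_⟩
  rcases le_or_gt x 2 with h | h
  · exact (hK x ⟨hx, h⟩).trans (le_max_left _ _)
  · rw [hΦ.support x h, abs_zero]
    exact le_max_right _ _

/-- Tail estimate for a geometric series. -/
theorem sum_range_geometric_tail_le {q B X : ℝ} (hq0 : 0 < q) (hq1 : q < 1) (hB : 0 ≤ B)
    (hX : 0 ≤ X) (n : ℕ) :
    ∑ k ∈ Finset.range n, (if B * q ^ k ≤ X then B * q ^ k else 0) ≤ X / (1 - q) := by
  have h1q : 0 < 1 - q := by linarith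
  -- `U k = min (B q ^ k) X / (1 - q)` telescopes, and each term below the threshold is at most the
  -- drop of `U` at `k`.
  set U : ℕ → ℝ := fun k => min (B * q ^ k / (1 - q)) (X / (1 - q)) with hU
  have hstep : ∀ k, (if B * q ^ k ≤ X then B * q ^ k else 0) ≤ U k - U (k + 1) := by
    intro k
    have hmono : B * q ^ (k + 1) ≤ B * q ^ k :=
      mul_le_mul_of_nonneg_left (pow_le_pow_of_le_one hq0.le hq1.le (Nat.le_succ k)) hB
    split_ifs with h
    · have h1 : U k = B * q ^ k / (1 - q) := min_eq_left (by gcongr)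
      have h2 : U (k + 1) ≤ B * q ^ (k + 1) / (1 - q) := min_le_left _ _
      have h3 : B * q ^ k / (1 - q) - B * q ^ (k + 1) / (1 - q) = B * q ^ k := by
        rw [pow_succ]
        field_simp
      linarith
    · have : U (k + 1) ≤ U k := min_le_min_right _ (by gcongr)
      linarith
  calc _ ≤ ∑ k ∈ Finset.range n, (U k - U (k + 1)) := Finset.sum_le_sum fun k _ => hstep k
    _ = U 0 - U n := Finset.sum_range_sub' U n
    _ ≤ X / (1 - q) - 0 := by
        refine sub_le_sub (min_le_right _ _) (le_min ?_ ?_) <;> positivity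
    _ = _ := sub_zero _

/-- A function in the unit ball of the Besov space with prescribed coefficients along a sequence
of eigenvectors whose eigenvalues grow geometrically. -/
theorem exists_besov_function {L : E →ₗ.[ℝ] E}
    (horth : ∀ l m : ℝ, l ≠ m → ∀ u v, (u, l • u) ∈ L.graph → (v, m • v) ∈ L.graph →
      ⟪u, v⟫_ℝ = 0) {Φ : ℝ → ℝ} (hΦ : IsLittlewoodPaley Φ) {s : ℝ} (hs : 0 < s) {e₀ : E}
    (he₀ : ‖e₀‖ = 1) (he₀' : (e₀, (0 : ℝ) • e₀) ∈ L.graph) {v : ℕ → E} {m : ℕ → ℝ}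
    (hv : ∀ n, ‖v n‖ = 1) (hv' : ∀ n, (v n, m n • v n) ∈ L.graph) {β Λ : ℝ} (hβ : 1 < β)
    (hΛ : 1 ≤ Λ) (hm : ∀ n, Λ * β ^ n < m n) (hm' : ∀ n, m n < Λ * β ^ (n + 1)) :
    ∃ (f : E) (δ : ℝ), 0 < δ ∧ besovNorm L Φ s f ≤ 1 ∧ ‖f‖ = 1 ∧
      ∀ n, ⟪v n, f⟫_ℝ = δ * (Λ * β ^ n) ^ (-s / 2) := by
  obtain ⟨K, hK0, hK⟩ := hΦ.exists_bound
  have hβ0 : 0 < β := by linarith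
  have hΛ0 : 0 < Λ := by linarith
  set q : ℝ := β ^ (-s) with hq
  have hq0 : 0 < q := Real.rpow_pos_of_pos hβ0 _
  have hq1 : q < 1 := Real.rpow_lt_one_of_one_lt_of_neg hβ (by linarith)
  have h1q : 0 < 1 - q := by linarith
  set B : ℝ := Λ ^ (-s) with hB
  have hB0 : 0 < B := Real.rpow_pos_of_pos hΛ0 _
  have hB1 : B ≤ 1 := Real.rpow_le_one_of_one_le_of_nonpos hΛ (by linarith)
  have hpow : ∀ n : ℕ, (Λ * β ^ n) ^ (-s) = B * q ^ n := by
    intro n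
    rw [Real.mul_rpow hΛ0.le (by positivity), hB, hq, ← Real.rpow_natCast, ← Real.rpow_natCast,
      ← Real.rpow_mul hβ0.le, ← Real.rpow_mul hβ0.le, mul_comm (n : ℝ)]
  -- Normalises the Besov tail: `|Φ - 1| ≤ K + 1`, the geometric tail gives `1 / (1 - q)`, and a
  -- shift by one index gives `1 / q`.
  set δ : ℝ := √((1 - q) * q) / (K + 1) with hδ
  have hδ0 : 0 < δ := by positivity
  have hδ2 : δ ^ 2 * (K + 1) ^ 2 = (1 - q) * q := by
    rw [hδ, div_pow, Real.sq_sqrt (by positivity)]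
    field_simp
  set d : ℕ → ℝ := fun n => δ * (Λ * β ^ n) ^ (-s / 2) with hd
  have hd2 : ∀ n, d n ^ 2 = δ ^ 2 * (B * q ^ n) := by
    intro n
    rw [hd, mul_pow, ← hpow, ← Real.rpow_natCast ((Λ * β ^ n) ^ (-s / 2)),
      ← Real.rpow_mul (by positivity)]
    congr 2
    push_cast
    ring
  have hdsum : HasSum (fun n => d n ^ 2) (δ ^ 2 * (B * (1 - q)⁻¹)) := by
    simp only [hd2]
    exact ((hasSum_geometric_of_lt_one hq0.le hq1).mul_left B).mul_left (δ ^ 2)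
  have hdle : δ ^ 2 * (B * (1 - q)⁻¹) ≤ 1 := by
    have h1 : δ ^ 2 ≤ 1 - q := by
      calc δ ^ 2 ≤ δ ^ 2 * (K + 1) ^ 2 := by
            refine le_mul_of_one_le_right (sq_nonneg _) (one_le_pow₀ ?_)
            linarith
        _ = (1 - q) * q := hδ2
        _ ≤ 1 - q := mul_le_of_le_one_right h1q.le hq1.le
    calc δ ^ 2 * (B * (1 - q)⁻¹) ≤ (1 - q) * (1 * (1 - q)⁻¹) := by gcongr
      _ = 1 := by rw [one_mul, mul_inv_cancel₀ h1q.ne']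
  -- Index `0` carries eigenvalue `0` with the coefficient that completes the norm to one. It does
  -- not affect the Besov functional since `Φ 0 = 1`.
  set e : ℕ → E := fun n => Nat.casesOn n e₀ v with he
  set M : ℕ → ℝ := fun n => Nat.casesOn n 0 m with hM
  set c : ℕ → ℝ := fun n => Nat.casesOn n (√(1 - δ ^ 2 * (B * (1 - q)⁻¹))) d with hc
  have hMmono : StrictMono M := by
    refine strictMono_nat_of_lt_succ fun n => ?_
    cases n with
    | zero => exact lt_trans (by positivity) (hm 0)
    | succ n => exact (hm' n).trans (hm (n + 1))
  have hegraph : ∀ n, (e n, M n • e n) ∈ L.graph := by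
    intro n
    cases n with
    | zero => exact he₀'
    | succ n => exact hv' n
  have heon : Orthonormal ℝ e := by
    refine ⟨fun n => ?_, fun i j hij => horth _ _ (hMmono.injective.ne hij) _ _ (hegraph i)
      (hegraph j)⟩
    cases n with
    | zero => exact he₀
    | succ n => exact hv n
  have hcsum : HasSum (fun n => c n ^ 2) 1 := by
    rw [← hasSum_nat_add_iff' 1]
    have : c 0 ^ 2 = 1 - δ ^ 2 * (B * (1 - q)⁻¹) := Real.sq_sqrt (by linarith)
    rw [Finset.sum_range_one, this, sub_sub_cancel]
    exact hdsum
  obtain ⟨f, hf⟩ := Orthonormal.exists_hasSum heon hcsum.summable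
  refine ⟨f, δ, hδ0, ?_, ?_, fun n => Orthonormal.inner_hasSum heon hf (n + 1)⟩
  · refine iSup_le fun j => ?_
    rw [ENNReal.ofReal_le_one]
    set F : ℝ → ℝ := fun x => Φ (2 ^ (-(j : ℝ)) * x) with hF
    have hFK : ∀ x, 0 ≤ x → |F x| ≤ K := fun x hx => hK _ (by positivity)
    have hgsum : Summable fun n => (F √(M n) * c n) ^ 2 := by
      refine Summable.of_nonneg_of_le (fun n => sq_nonneg _) (fun n => ?_)
        (hcsum.summable.mul_left (K ^ 2))
      rw [mul_pow]
      refine mul_le_mul_of_nonneg_right ?_ (sq_nonneg _)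
      exact sq_le_sq' (abs_le.1 (hFK _ (Real.sqrt_nonneg _))).1
        (abs_le.1 (hFK _ (Real.sqrt_nonneg _))).2
    obtain ⟨g, hg⟩ := Orthonormal.exists_hasSum heon hgsum
    rw [hasSum_sqrtCalculus horth hMmono.injective hegraph hf hg]
    have hgf : HasSum (fun n => ((F √(M n) - 1) * c n) • e n) (g - f) := by
      refine (hg.sub hf).congr_fun fun n => ?_
      rw [← sub_smul, sub_mul, one_mul]
    have hnorm := Orthonormal.hasSum_norm_sq heon hgf
    have hlow : ∀ x, 0 ≤ x → x ≤ 4 ^ j → F √x = 1 := by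
      intro x hx hx4
      refine hΦ.eq_one (by positivity) ?_
      have : √x ≤ 2 ^ j := by
        rw [Real.sqrt_le_left (by positivity), ← pow_mul, mul_comm, pow_mul]
        norm_num
        exact hx4
      rw [Real.rpow_neg (by norm_num), Real.rpow_natCast, inv_mul_le_iff₀ (by positivity)]
      linarith
    -- The cutoff alters only terms with `m n > 4 ^ j`. Then `Λ * β ^ (n + 1) > 4 ^ j`, that is `B *
    -- q ^ (n + 1) ≤ (4 ^ j) ^ (-s)`; the shift to `n` costs `q⁻¹`.
    set X : ℝ := ((4 : ℝ) ^ j) ^ (-s) * q⁻¹ with hX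
    have hX0 : 0 < X := by positivity
    have hterm : ∀ n, ((F √(m n) - 1) * d n) ^ 2 ≤
        (K + 1) ^ 2 * δ ^ 2 * (if B * q ^ n ≤ X then B * q ^ n else 0) := by
      intro n
      have hmpos : 0 < m n := lt_trans (by positivity) (hm n)
      split_ifs with h
      · rw [mul_pow, hd2, mul_assoc]
        refine mul_le_mul_of_nonneg_right ?_ (by positivity)
        have h1 := abs_le.1 (hFK _ (Real.sqrt_nonneg (m n)))
        refine sq_le_sq' (by linarith) (by linarith)
      · rw [hlow (m n) hmpos.le]
        · simp
        · by_contra! hcon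
          refine h ?_
          have h1 : (4 : ℝ) ^ j ≤ Λ * β ^ (n + 1) := (hcon.trans (hm' n)).le
          have h2 := Real.rpow_le_rpow_of_nonpos (by positivity) h1 (neg_nonpos.2 hs.le)
          rw [hpow, pow_succ, ← mul_assoc] at h2
          rw [hX, ← div_eq_mul_inv, le_div_iff₀ hq0]
          exact h2
    have hnorm2 : ‖g - f‖ ^ 2 ≤ (K + 1) ^ 2 * δ ^ 2 * (X / (1 - q)) := by
      have hshift := (hasSum_nat_add_iff' 1).2 hnorm
      have hz : F √(M 0) = 1 := hlow 0 le_rfl (by positivity)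
      rw [Finset.sum_range_one, hz, sub_self, zero_mul, zero_pow two_ne_zero, sub_zero] at hshift
      refine le_of_tendsto' hshift.tendsto_sum_nat fun n => ?_
      calc _ ≤ ∑ k ∈ Finset.range n,
            (K + 1) ^ 2 * δ ^ 2 * (if B * q ^ k ≤ X then B * q ^ k else 0) :=
            Finset.sum_le_sum fun k _ => hterm k
        _ ≤ _ := by
            rw [← Finset.mul_sum]
            exact mul_le_mul_of_nonneg_left
              (sum_range_geometric_tail_le hq0 hq1 hB0.le hX0.le n) (by positivity)
    have hval : (K + 1) ^ 2 * δ ^ 2 * (X / (1 - q)) = ((2 ^ (s * j))⁻¹) ^ 2 := by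
      rw [mul_comm ((K + 1) ^ 2), hδ2, hX]
      have : ((4 : ℝ) ^ j) ^ (-s) = ((2 ^ (s * j))⁻¹) ^ 2 := by
        rw [← Real.rpow_neg (by norm_num), ← Real.rpow_natCast (2 ^ (-(s * j))),
          ← Real.rpow_mul (by norm_num), show (4 : ℝ) = 2 ^ (2 : ℝ) by norm_num,
          ← Real.rpow_natCast, ← Real.rpow_mul (by norm_num), ← Real.rpow_mul (by norm_num)]
        congr 1
        push_cast
        ring
      rw [this]
      field_simp
    rw [hval] at hnorm2
    have hfin := le_of_sq_le_sq hnorm2 (by positivity)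
    calc (2 : ℝ) ^ (s * j) * ‖g - f‖ ≤ 2 ^ (s * j) * (2 ^ (s * j))⁻¹ := by gcongr
      _ = 1 := mul_inv_cancel₀ (by positivity)
  · have := (Orthonormal.hasSum_norm_sq heon hf).unique hcsum
    exact (pow_eq_one_iff_of_nonneg (norm_nonneg f) two_ne_zero).1 this

end LacunarySeries

/-! ### Lower bound for approximants by duality -/

section LowerBound

variable {M : Type*} [MetricSpace M] [CompactSpace M] [Nonempty M] [MeasurableSpace M]
  [BorelSpace M] {μ : Measure M} [IsFiniteMeasure μ] {N : ℕ}
  {S : ℝ → Lp ℝ 2 μ →L[ℝ] Lp ℝ 2 μ} {P : ℝ → M → M → ℝ}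

/-- Any element of the reproducing kernel Hilbert space that is close to `f` in `L²` has large norm
if `f` correlates with a vector that is damped by the semigroup. -/
theorem IsHeatKernel.inner_sub_le (hP : IsHeatKernel μ S P) (hN : DoublingExp μ N)
    (hG : GaussianBounds μ P) {t : ℝ} (ht : 0 < t) [Fact (kernelMatrix (P t)).PosSemidef]
    {f : Lp ℝ 2 μ} {ε : ℝ} (hε : 0 < ε) {h : RKHS.OfKernel (kernelMatrix (P t))}
    (hf : eLpNorm (fun x => f x - h x) 2 μ ≤ ENNReal.ofReal ε) (v : Lp ℝ 2 μ) :
    ⟪v, f⟫_ℝ - ε * ‖v‖ ≤ ‖S (t / 2) v‖ * ‖h‖ := by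
  obtain ⟨K, hK, hbd⟩ := hP.rkhs_exists_bound hN hG ht
  have hmem : MemLp (h : M → ℝ) 2 μ := MemLp.of_bound
    (hP.rkhs_measurable ht h).aestronglyMeasurable (K * ‖h‖) (ae_of_all _ fun x => hbd h x)
  have hdist : ‖f - hmem.toLp _‖ ≤ ε := by
    rw [Lp.norm_def]
    refine ENNReal.toReal_le_of_le_ofReal hε.le ?_
    refine le_trans (le_of_eq (eLpNorm_congr_ae ?_)) hf
    filter_upwards [Lp.coeFn_sub f (hmem.toLp _), hmem.coeFn_toLp] with x h1 h2
    rw [h1, Pi.sub_apply, h2]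
  have hpair := hP.rkhs_pairing_le hN hG ht h v
  have hinner : ∫ x, v x * h x ∂μ = ⟪v, hmem.toLp _⟫_ℝ := by
    rw [inner_Lp_eq_integral]
    refine integral_congr_ae ?_
    filter_upwards [hmem.coeFn_toLp] with x hx
    rw [hx]
  rw [hinner] at hpair
  have h1 : ⟪v, f⟫_ℝ - ⟪v, hmem.toLp _⟫_ℝ ≤ ‖v‖ * ε := by
    rw [← inner_sub_right]
    exact (real_inner_le_norm _ _).trans (mul_le_mul_of_nonneg_left hdist (norm_nonneg _))
  have h2 := (le_abs_self _).trans hpair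
  linarith

end LowerBound

theorem exists_crossing {d : ℕ → ℝ} (hd : Tendsto d atTop (𝓝 0)) {a : ℝ} (ha : 0 < a)
    (h0 : a ≤ d 0) : ∃ n, a ≤ d n ∧ d (n + 1) < a := by
  by_contra! hcon
  have hall : ∀ n, a ≤ d n := fun n => by
    induction n with
    | zero => exact h0
    | succ n ih => exact hcon n ih
  exact absurd (ge_of_tendsto' hd hall) (not_le.2 ha)

/-- Inverting a power law. -/
theorem mul_rpow_le_of_mul_rpow_lt {δ x ε s : ℝ} (hδ : 0 < δ) (hx : 0 < x) (hε : 0 < ε) (hs : 0 < s)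
    (h : δ * x ^ (-s / 2) < 2 * ε) : (δ / 2) ^ (2 / s) * ε ^ (-2 / s) ≤ x := by
  have h1 : x ^ (-s / 2) ≤ 2 * ε / δ := by
    rw [le_div_iff₀ hδ, mul_comm]
    exact h.le
  have h2 := Real.rpow_le_rpow_of_nonpos (Real.rpow_pos_of_pos hx _) h1
    (show -2 / s ≤ 0 from div_nonpos_of_nonpos_of_nonneg (by norm_num) hs.le)
  rw [← Real.rpow_mul hx.le, show -s / 2 * (-2 / s) = 1 by field_simp, Real.rpow_one] at h2
  refine le_trans (le_of_eq ?_) h2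
  rw [show 2 * ε / δ = (δ / 2)⁻¹ * ε by field_simp, Real.mul_rpow (by positivity) hε.le,
    Real.inv_rpow (by positivity), ← Real.rpow_neg (by positivity), neg_div, neg_neg]

end HeatRKHS

/-! ### Proof of the theorem -/

theorem theorem7 {M : Type*} [MetricSpace M] [CompactSpace M] [Infinite M]
    [MeasurableSpace M] [BorelSpace M] (μ : Measure M) [IsFiniteMeasure μ]
    (hμ : HeatRKHS.Doubling μ)
    (L : Lp ℝ 2 μ →ₗ.[ℝ] Lp ℝ 2 μ) (hL : IsSelfAdjoint L)
    (hLpos : ∀ f : L.domain, 0 ≤ ⟪L f, (f : Lp ℝ 2 μ)⟫_ℝ)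
    (S : ℝ → Lp ℝ 2 μ →L[ℝ] Lp ℝ 2 μ) (hS : HeatRKHS.IsSemigroupOf L S)
    (P : ℝ → M → M → ℝ) (hP : HeatRKHS.IsHeatKernel μ S P)
    (hPbounds : HeatRKHS.GaussianBounds μ P)
    (Φ : ℝ → ℝ) (hΦ : HeatRKHS.IsLittlewoodPaley Φ)
    (s : ℝ) (hs : 0 < s) :
    ∃ f : Lp ℝ 2 μ, HeatRKHS.besovNorm L Φ s f ≤ 1 ∧ ‖f‖ = 1 ∧
      ∃ c : ℝ, 0 < c ∧ ∀ ε₀ : ℝ, 0 < ε₀ → ε₀ < 1 → ∃ C : ℝ, 0 < C ∧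
        ∀ (t : ℝ) (ht : 0 < t), t ≤ 1 → ∀ ε : ℝ, 0 < ε → ε ≤ ε₀ →
          ENNReal.ofReal (C * ε ^ 2 * Real.exp (c * t * ε ^ (-2 / s))) ≤
            HeatRKHS.rkhsApprox μ (P t) (hP.posSemidef ht) f ε := by
  obtain ⟨N, hN⟩ := hμ.exists_doublingExp
  have hsym := hP.symmetric hN hPbounds
  obtain ⟨ι, b, l, hl, hb⟩ := hS.exists_eigenbasis hsym hLpos (t₀ := 1 / 2) (by norm_num)
    (hP.isCompactOperator hN hPbounds (by norm_num) (by norm_num))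
  obtain ⟨β, Λ, hΛ, hwin⟩ := hP.exists_window hN hPbounds hb hl
  have hΛ0 : 0 < Λ := by linarith
  have hβ : 1 < β := by
    obtain ⟨i, h1, h2⟩ := hwin Λ le_rfl
    by_contra! h
    nlinarith
  have hβ0 : 0 < β := by linarith
  have hwin' : ∀ n : ℕ, ∃ i, Λ * β ^ n < l i ∧ l i < Λ * β ^ (n + 1) := by
    intro n
    obtain ⟨i, h1, h2⟩ := hwin (Λ * β ^ n)
      (le_mul_of_one_le_right hΛ0.le (one_le_pow₀ hβ.le))
    exact ⟨i, h1, h2.trans_eq (by ring)⟩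
  choose i hi1 hi2 using hwin'
  have hone : Lp.const 2 μ (1 : ℝ) ≠ 0 := by
    intro h0
    obtain ⟨x⟩ : Nonempty M := inferInstance
    have hx := hN.pos x one_pos
    have h1 := Lp.coeFn_const (p := 2) (μ := μ) (1 : ℝ)
    rw [h0] at h1
    have h2 : ∀ᵐ _ : M ∂μ, False := by
      filter_upwards [h1, Lp.coeFn_zero ℝ 2 μ] with x h3 h4
      rw [h3] at h4
      exact one_ne_zero h4
    rw [eventually_false_iff_eq_bot, ae_eq_bot] at h2
    rw [h2] at hx
    simp at hx
  have hconst : ∀ t, 0 ≤ t → S t ((‖Lp.const 2 μ (1 : ℝ)‖)⁻¹ • Lp.const 2 μ (1 : ℝ)) =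
      Real.exp (-0 * t) • ((‖Lp.const 2 μ (1 : ℝ)‖)⁻¹ • Lp.const 2 μ (1 : ℝ)) := by
    intro t ht
    rw [neg_zero, zero_mul, Real.exp_zero, one_smul, map_smul]
    rcases ht.eq_or_lt with rfl | ht
    · rw [hS.zero]
      rfl
    · rw [hP.apply_const_one ht]
  obtain ⟨f, δ, hδ, hbes, hnorm, hcoef⟩ := HeatRKHS.exists_besov_function (L := L)
    (fun l m hlm u v hu hv => hS.inner_eq_zero hsym hlm hu hv) hΦ hs
    (norm_smul_inv_norm (𝕜 := ℝ) hone) (hS.mem_graph hconst)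
    (v := fun n => b (i n)) (m := fun n => l (i n)) (fun n => b.orthonormal.1 _)
    (fun n => hS.mem_graph (hb (i n))) hβ hΛ hi1 hi2
  -- The division by `β` in `c` pays for the passage from the crossing index `n + 1` to `n`. In `C`,
  -- the entry `1` serves small `ε` and the other entry `ε` too large for the first coefficient.
  refine ⟨f, hbes, hnorm, (δ / 2) ^ (2 / s) / β, by positivity, fun ε₀ hε₀ hε₀1 =>
    ⟨min 1 ((1 - ε₀) ^ 2 * Real.exp (-Λ)), lt_min one_pos
      (mul_pos (pow_pos (by linarith) 2) (Real.exp_pos _)), fun t ht ht1 ε hε hεε₀ => ?_⟩⟩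
  have : Fact (HeatRKHS.kernelMatrix (P t)).PosSemidef := ⟨hP.posSemidef ht⟩
  refine le_iInf fun h => le_iInf fun hh => ENNReal.ofReal_le_ofReal ?_
  have hlow := hP.inner_sub_le hN hPbounds ht hε hh
  have hlim : Tendsto (fun n : ℕ => δ * (Λ * β ^ n) ^ (-s / 2)) atTop (𝓝 0) := by
    have h1 : Tendsto (fun n : ℕ => Λ * β ^ n) atTop atTop :=
      (tendsto_pow_atTop_atTop_of_one_lt hβ).const_mul_atTop hΛ0
    have h2 := ((tendsto_rpow_neg_atTop (half_pos hs)).comp h1).const_mul δ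
    rw [mul_zero] at h2
    simpa only [neg_div] using! h2
  rcases le_or_gt (2 * ε) (δ * (Λ * β ^ 0) ^ (-s / 2)) with hcase | hcase
  -- The last coefficient before the sequence drops below `2ε`: being at least `2ε`, it leaves `ε`
  -- after the approximation error, and the smallness of the next one forces `Λ * β ^ (n + 1)` to be
  -- at least of order `ε ^ (-2 / s)`.
  · obtain ⟨n, hn1, hn2⟩ := HeatRKHS.exists_crossing hlim (by positivity) hcase
    have h1 := hlow (b (i n))
    rw [hcoef, b.orthonormal.1, hb _ _ (by positivity), norm_smul, b.orthonormal.1, mul_one,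
      mul_one, Real.norm_of_nonneg (Real.exp_pos _).le] at h1
    have h2 : ε * Real.exp (l (i n) * (t / 2)) ≤ ‖h‖ := by
      rw [neg_mul, Real.exp_neg, ← div_eq_inv_mul, le_div_iff₀ (Real.exp_pos _)] at h1
      exact le_trans (mul_le_mul_of_nonneg_right (by linarith) (Real.exp_pos _).le) h1
    have h3 := HeatRKHS.mul_rpow_le_of_mul_rpow_lt hδ (by positivity) hε hs hn2
    have h4 : (δ / 2) ^ (2 / s) / β * ε ^ (-2 / s) ≤ l (i n) := by
      rw [div_mul_eq_mul_div, div_le_iff₀ hβ0]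
      refine h3.trans ?_
      rw [pow_succ, ← mul_assoc]
      exact mul_le_mul_of_nonneg_right (hi1 n).le hβ0.le
    calc min 1 ((1 - ε₀) ^ 2 * Real.exp (-Λ)) * ε ^ 2 *
          Real.exp ((δ / 2) ^ (2 / s) / β * t * ε ^ (-2 / s))
        ≤ 1 * ε ^ 2 * Real.exp (l (i n) * t) := by
          refine mul_le_mul (mul_le_mul_of_nonneg_right (min_le_left _ _) (sq_nonneg _))
            (Real.exp_le_exp.2 ?_) (Real.exp_pos _).le (by positivity)
          rw [mul_right_comm]
          exact mul_le_mul_of_nonneg_right h4 ht.le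
      _ = (ε * Real.exp (l (i n) * (t / 2))) ^ 2 := by
          rw [mul_pow, ← Real.exp_nat_mul, one_mul]
          congr 2
          push_cast
          ring
      _ ≤ ‖h‖ ^ 2 := by gcongr
  -- Here `ε` is bounded below, so the exponential is at most `exp Λ`, and testing with `f` itself
  -- gives `‖h‖ ≥ 1 - ε₀`.
  · rw [pow_zero, mul_one] at hcase
    have h1 := hlow f
    rw [hnorm, mul_one, real_inner_self_eq_norm_sq, hnorm, one_pow] at h1
    have h2 : ‖S (t / 2) f‖ ≤ 1 :=
      (HeatRKHS.norm_semigroup_le hsym hb hl (half_pos ht) f).trans hnorm.le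
    have h3 : 1 - ε₀ ≤ ‖h‖ := by
      have := mul_le_mul_of_nonneg_right h2 (norm_nonneg h)
      linarith
    have h4 := HeatRKHS.mul_rpow_le_of_mul_rpow_lt hδ hΛ0 hε hs hcase
    have h5 : (δ / 2) ^ (2 / s) / β * t * ε ^ (-2 / s) ≤ Λ := by
      have h6 : 0 ≤ (δ / 2) ^ (2 / s) * ε ^ (-2 / s) := by positivity
      calc (δ / 2) ^ (2 / s) / β * t * ε ^ (-2 / s)
          = (δ / 2) ^ (2 / s) * ε ^ (-2 / s) * (t / β) := by ring
        _ ≤ (δ / 2) ^ (2 / s) * ε ^ (-2 / s) * 1 := by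
            refine mul_le_mul_of_nonneg_left ?_ h6
            rw [div_le_one hβ0]
            linarith
        _ ≤ Λ := by rwa [mul_one]
    calc min 1 ((1 - ε₀) ^ 2 * Real.exp (-Λ)) * ε ^ 2 *
          Real.exp ((δ / 2) ^ (2 / s) / β * t * ε ^ (-2 / s))
        ≤ (1 - ε₀) ^ 2 * Real.exp (-Λ) * 1 * Real.exp Λ := by
          gcongr
          · exact min_le_right _ _
          · exact pow_le_one₀ hε.le (by linarith)
      _ = (1 - ε₀) ^ 2 := by
          rw [mul_one, mul_assoc, ← Real.exp_add, neg_add_cancel, Real.exp_zero, mul_one]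
      _ ≤ ‖h‖ ^ 2 := by
          refine pow_le_pow_left₀ (by linarith) h3 2
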